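/- Consider the system of partial differential equations for four unknown functions $e,\varepsilon,\langle\rho_1\rangle,\langle\rho'^2\rangle$ of $(x,y,z)$ (with free stream velocity $U_0=1$) $$\frac{\partial e}{\partial x}=\frac{\partial}{\partial y}\Big(C_e\frac{e^2}{\varepsilon}\frac{\partial e}{\partial y}\Big)+\frac{\partial}{\partial z}\Big(C_e\frac{e^2}{\varepsilon}\frac{\partial e}{\partial z}\Big)-\varepsilon,\tag{1}$$ $$\frac{\partial \varepsilon}{\partial x}=\frac{\partial}{\partial y}\Big(C_\varepsilon\frac{e^2}{\varepsilon}\frac{\partial \varepsilon}{\partial y}\Big)+\frac{\partial}{\partial z}\Big(C_\varepsilon\frac{e^2}{\varepsilon}\frac{\partial \varepsilon}{\partial z}\Big)-C_{\varepsilon2}\frac{\varepsilon^2}{e},\tag{2}$$ $$\frac{\partial \langle\rho_1\rangle}{\partial x}=\frac{\partial}{\partial y}\Big(C_\rho\frac{e^2}{\varepsilon}\frac{\partial \langle\rho_1\rangle}{\partial y}\Big)+\frac{\partial}{\partial z}\Big(C_\rho\frac{e^2}{\varepsilon}\frac{\partial \langle\rho_1\rangle}{\partial z}\Big)-\frac{\partial}{\partial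 z}\Big(C_\rho\frac{e^2}{\varepsilon}\Big),\tag{3}$$ $$\frac{\partial \langle\rho'^2\rangle}{\partial x}=\frac{\partial}{\partial y}\Big(C_{1\rho}\frac{e^2}{\varepsilon}\frac{\partial \langle\rho'^2\rangle}{\partial y}\Big)+\frac{\partial}{\partial z}\Big(C_{1\rho}\frac{e^2}{\varepsilon}\frac{\partial \langle\rho'^2\rangle}{\partial z}\Big)+2C_\rho\frac{e^2}{\varepsilon}\Big(\frac{\partial \langle\rho_1\rangle}{\partial y}\Big)^2+2C_\rho\frac{e^2}{\varepsilon}\Big(\frac{\partial \langle\rho_1\rangle}{\partial z}-1\Big)^2-C_T\frac{\langle\rho'^2\rangle\varepsilon}{e},\tag{4}$$ where $C_e=0.136$, $C_\varepsilon=C_e/1.3$, $C_{\varepsilon2}=1.92$, $C_\rho=0.208$, $C_{1\rho}=0.087$, $C_T=1.25$. Let $M$ be a nonempty connected open subset of the part $\{e\neq0,\ \varepsilon\neq0\}$ of the space $\mathbb R^7$ of the variables $(x,y,z,e,\varepsilon,\langle\rho_1\rangle,\langle\rho'^2\rangle)$; for instance $M=\{e>0,\ \varepsilon>0\}$. A $C^\infty$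 vector field $v$ on $M$ is called an infinitesimal point symmetry of (1)–(4) if its second prolongation $\mathrm{pr}^{(2)}v$ annihilates each of the four equations (written as left-hand side minus right-hand side, as functions on the second order jet space) at every second order jet over $M$ that satisfies all four equations. Then a vector field $v$ on $M$ is an infinitesimal point symmetry of (1)–(4) if and only if it is a linear combination, with constant real coefficients, of the restrictions to $M$ of the eight vector fields $$X_1=\frac{\partial}{\partial x},\quad X_2=\frac{\partial}{\partial y},\quad X_3=\frac{\partial}{\partial z},\quad X_4=\frac{\partial}{\partial\langle\rho_1\rangle},\quad X_5=-z\frac{\partial}{\partial y}+y\frac{\partial}{\partial z}+y\frac{\partial}{\partial\langle\rho_1\rangle},$$ $$X_6=y\frac{\partial}{\partial y}+z\frac{\partial}{\partial z}+2e\frac{\partial}{\partial e}+2\varepsilon\frac{\partial}{\partial\varepsilon}+\langle\rho_1\rangle\frac{\partial}{\partial\langle\rho_1\rangle}+2\langle\rho'^2\rangle\frac{\partial}{\partial\langle\rho'^2\rangle},$$ $$X_7=x\frac{\partial}{\partial x}-2e\frac{\partial}{\partial e}-3\varepsilon\frac{\partial}{\partial\varepsilon},\qquad X_8=(\langle\rho_1\rangle-z)\frac{\partial}{\partial\langle\rho_1\rangle}+2\langle\rho'^2\rangle\frac{\partial}{\partial\langle\rho'^2\rangle}.$$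 These eight vector fields are linearly independent over $\mathbb R$ on $M$, and the infinitesimal point symmetries on $M$ are closed under the Lie bracket; thus they form a Lie algebra of dimension eight with basis $X_1,\dots,X_8$. -/

import Mathlib

open scoped ContDiff

noncomputable section

namespace FarWake

/-! ### The space of variables and its jet spaces

The independent variables are `x, y, z` (indices `0, 1, 2`); the dependent variables are
`e, ε, ⟨ρ₁⟩, ⟨ρ'²⟩` (indices `0, 1, 2, 3`). -/

/-- The space of independent and dependent variables: a point is a pair
`((x, y, z), (e, ε, ⟨ρ₁⟩, ⟨ρ'²⟩))`. -/
abbrev Base : Type := (Fin 3 → ℝ) × (Fin 4 → ℝ)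

/-- First order jets `(p, u₁)`, where `u₁ α i` is the coordinate of the derivative of the
`α`-th dependent variable with respect to the `i`-th independent variable. -/
abbrev Jet1 : Type := Base × (Fin 4 → Fin 3 → ℝ)

/-- Second order jet coordinates `((p, u₁), u₂)`, where `u₂ α i k` is the coordinate of the
derivative of the `α`-th dependent variable with respect to the `i`-th and the `k`-th independent
variables. The actual jets are those that satisfy `IsJet`. -/
abbrev Jet2 : Type := Jet1 × (Fin 4 → Fin 3 → Fin 3 → ℝ)

/-- Mixed second derivatives commute. -/
def IsJet (j : Jet2) : Prop := ∀ α i k, j.2 α i k = j.2 α k i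

/-- The total derivative `D_i F = ∂F/∂x_i + ∑_β u^β_i ∂F/∂u^β` of a function `F` of the independent
and dependent variables. -/
def totalDeriv₀ (F : Base → ℝ) (i : Fin 3) (j : Jet1) : ℝ :=
  fderiv ℝ F j.1 (Pi.single i 1, fun β => j.2 β i)

/-- The total derivative
`D_i F = ∂F/∂x_i + ∑_β u^β_i ∂F/∂u^β + ∑_{β,k} u^β_{ki} ∂F/∂u^β_k` of a function `F` on the first
jet space. -/
def totalDeriv₁ (F : Jet1 → ℝ) (i : Fin 3) (j : Jet2) : ℝ :=
  fderiv ℝ F j.1 ((Pi.single i 1, fun β => j.1.2 β i), fun β k => j.2 β k i)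

/-! ### The model -/

/-- The empirical constant `C_e`. -/
def Ce : ℝ := 0.136
/-- The empirical constant `δ`. -/
def δ : ℝ := 1.3
/-- The empirical constant `C_ε = C_e / δ`. -/
def Cε : ℝ := Ce / δ
/-- The empirical constant `C_{ε2}`. -/
def Cε₂ : ℝ := 1.92
/-- The empirical constant `C_ρ`. -/
def Cρ : ℝ := 0.208
/-- The empirical constant `C_{1ρ}`. -/
def C₁ρ : ℝ := 0.087
/-- The empirical constant `C_T`. -/
def CT : ℝ := 1.25
/-- The free stream velocity `U₀`. -/
def U₀ : ℝ := 1

/-- The turbulent kinetic energy `e`. -/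
def e (p : Base) : ℝ := p.2 0
/-- The dissipation rate `ε`. -/
def ε (p : Base) : ℝ := p.2 1
/-- The averaged density defect `⟨ρ₁⟩`. -/
def ρ₁ (p : Base) : ℝ := p.2 2
/-- The density fluctuation variance `⟨ρ'²⟩`. -/
def R (p : Base) : ℝ := p.2 3

/-- The common factor `e² / ε` of the diffusion coefficients. -/
def K (p : Base) : ℝ := e p ^ 2 / ε p

/-- The open set of the values of the variables for which the model makes sense. -/
def domain : Set Base := {p | e p ≠ 0 ∧ ε p ≠ 0}

/-- The diffusion term `∂/∂y (C (e²/ε) ∂u^α/∂y) + ∂/∂z (C (e²/ε) ∂u^α/∂z)`. -/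
def diffusion (C : ℝ) (α : Fin 4) (j : Jet2) : ℝ :=
  totalDeriv₁ (fun q => C * K q.1 * q.2 α 1) 1 j + totalDeriv₁ (fun q => C * K q.1 * q.2 α 2) 2 j

/-- The four equations of the model, each written as left-hand side minus right-hand side. -/
def Δ : Fin 4 → Jet2 → ℝ :=
  ![fun j => U₀ * j.1.2 0 0 - (diffusion Ce 0 j - ε j.1.1),
    fun j => U₀ * j.1.2 1 0 - (diffusion Cε 1 j - Cε₂ * (ε j.1.1 ^ 2 / e j.1.1)),
    fun j => U₀ * j.1.2 2 0 - (diffusion Cρ 2 j - totalDeriv₁ (fun q => Cρ * K q.1) 2 j),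
    fun j => U₀ * j.1.2 3 0 -
      (diffusion C₁ρ 3 j + 2 * Cρ * K j.1.1 * (j.1.2 2 1) ^ 2
        + 2 * Cρ * K j.1.1 * (j.1.2 2 2 - 1) ^ 2
        - CT * (R j.1.1 * ε j.1.1 / e j.1.1))]

/-! ### Prolongation and infinitesimal symmetries

A vector field `v` on the space of variables is given by its coefficients
`v p = (ξ p, φ p)`, that is `v = ∑_i ξ^i ∂/∂x_i + ∑_α φ^α ∂/∂u^α`. -/

/-- The coefficient `φ^α_i = D_i φ^α - ∑_l (D_i ξ^l) u^α_l` of the first prolongation. -/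
def prol₁ (v : Base → Base) (α : Fin 4) (i : Fin 3) (j : Jet1) : ℝ :=
  totalDeriv₀ (fun p => (v p).2 α) i j
    - ∑ l, totalDeriv₀ (fun p => (v p).1 l) i j * j.2 α l

/-- The coefficient `φ^α_{ik} = D_k φ^α_i - ∑_l (D_k ξ^l) u^α_{il}` of the second prolongation. -/
def prol₂ (v : Base → Base) (α : Fin 4) (i k : Fin 3) (j : Jet2) : ℝ :=
  totalDeriv₁ (prol₁ v α i) k j
    - ∑ l, totalDeriv₀ (fun p => (v p).1 l) k j.1 * j.2 α i l

/-- The second prolongation of the vector field `v`, a vector field on the second jet space. -/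
def prolongation (v : Base → Base) (j : Jet2) : Jet2 :=
  ((v j.1.1, fun α i => prol₁ v α i j.1), fun α i k => prol₂ v α i k j)

/-- A smooth vector field `v` on `M` is an infinitesimal (point) symmetry of the model if its
second prolongation annihilates each of the four equations at every second order jet over `M` that
satisfies the four equations. -/
def IsInfinitesimalSymmetry (M : Set Base) (v : Base → Base) : Prop :=
  ContDiffOn ℝ ∞ v M ∧
    ∀ j : Jet2, IsJet j → j.1.1 ∈ M → (∀ ν, Δ ν j = 0) →
      ∀ ν, fderiv ℝ (Δ ν) j (prolongation v j) = 0

/-! ### The eight vector fields -/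

/-- `∂/∂x` -/
def X₁ : Base → Base := fun _ => (![1, 0, 0], ![0, 0, 0, 0])
/-- `∂/∂y` -/
def X₂ : Base → Base := fun _ => (![0, 1, 0], ![0, 0, 0, 0])
/-- `∂/∂z` -/
def X₃ : Base → Base := fun _ => (![0, 0, 1], ![0, 0, 0, 0])
/-- `∂/∂⟨ρ₁⟩` -/
def X₄ : Base → Base := fun _ => (![0, 0, 0], ![0, 0, 1, 0])
/-- `-z ∂/∂y + y ∂/∂z + y ∂/∂⟨ρ₁⟩` -/
def X₅ : Base → Base := fun p => (![0, -p.1 2, p.1 1], ![0, 0, p.1 1, 0])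
/-- `y ∂/∂y + z ∂/∂z + 2 e ∂/∂e + 2 ε ∂/∂ε + ⟨ρ₁⟩ ∂/∂⟨ρ₁⟩ + 2 ⟨ρ'²⟩ ∂/∂⟨ρ'²⟩` -/
def X₆ : Base → Base := fun p => (![0, p.1 1, p.1 2], ![2 * e p, 2 * ε p, ρ₁ p, 2 * R p])
/-- `x ∂/∂x - 2 e ∂/∂e - 3 ε ∂/∂ε` -/
def X₇ : Base → Base := fun p => (![p.1 0, 0, 0], ![-2 * e p, -3 * ε p, 0, 0])
/-- `(⟨ρ₁⟩ - z) ∂/∂⟨ρ₁⟩ + 2 ⟨ρ'²⟩ ∂/∂⟨ρ'²⟩` -/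
def X₈ : Base → Base := fun p => (![0, 0, 0], ![0, 0, ρ₁ p - p.1 2, 2 * R p])

/-- The family of the eight vector fields. -/
def X : Fin 8 → Base → Base := ![X₁, X₂, X₃, X₄, X₅, X₆, X₇, X₈]

end FarWake

end

noncomputable section

namespace FarWake

/-! The equations can be solved for the `x`-derivatives, so over a point of `M` the remaining first
and second derivatives are free parameters (`solJet`). The symmetry condition is then an identity in
these parameters (`determining`), and subtracting instances of it isolates the determining
equations.

The mixed second derivatives (`mixed`) show that the `ξ^l` are free of the dependent variables, that
`ξ^0` is free of `y` and `z`, and give one Cauchy–Riemann equation for `(ξ^1, ξ^2)`. The pure ones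
(`second_order`) give the other, force `v(K) = (2 ξ^1_y - ξ^0_x) K`, and, because the four diffusion
constants are distinct, leave each `φ^α` dependent on its own variable only. Differentiating the
resulting relation between `φ^0` and `φ^1` in `e` and in `ε` makes these two components linear in
`e` and in `ε`.

The rest (`first_order`) is tested on coordinate gradients. The decay term `-ε` fixes the second
relation between the weights of `e` and `ε`, so that `φ^0_e = 2 (ξ^1_y - ξ^0_x)`. The left side does
not vary with `x, y, z`, and this cuts the conformal maps of the `(y, z)`-plane down to similarities
(`pd_pd_ξ_const`). The third equation is pure diffusion of `ρ₁ - z`, which explains the terms of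
`φ^2` tied to `ξ^2`. In the fourth, production is quadratic in the gradient of `ρ₁ - z`, so `R`
carries twice its weight, and the decay term leaves no further freedom in `φ^3`.

What survives is four constant rates (dilation in `x`, dilation and rotation in `(y, z)`, scaling of
`ρ₁ - z`) and four constants of integration: eight coefficients on a connected `M`. Conversely, the
combinations of the `X i` are affine, so second derivatives drop out of the prolongation and the
symmetry condition is a direct computation. Independence and brackets are read off from the linear
parts. -/

/-- The derivative of a function on the space of variables in a constant direction. -/
def pd (a : Base) (F : Base → ℝ) : Base → ℝ := fun p => fderiv ℝ F p a

/-! ### Calculus of directional derivatives on an open set. -/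

section DirectionalDerivatives

variable {M : Set Base} {F G : Base → ℝ} {p : Base}

theorem differentiableAt_of_contDiffOn (hMo : IsOpen M) (hF : ContDiffOn ℝ ∞ F M) (hp : p ∈ M) :
    DifferentiableAt ℝ F p :=
  (hF.contDiffAt (hMo.mem_nhds hp)).differentiableAt (by simp)

theorem differentiableAt_fderiv_of_contDiffOn (hMo : IsOpen M) (hF : ContDiffOn ℝ ∞ F M)
    (hp : p ∈ M) : DifferentiableAt ℝ (fderiv ℝ F) p :=
  ((hF.fderiv_of_isOpen hMo (m := ∞) (by simp)).contDiffAt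
    (hMo.mem_nhds hp)).differentiableAt (by simp)

theorem contDiffOn_pd (hMo : IsOpen M) (hF : ContDiffOn ℝ ∞ F M) (a : Base) :
    ContDiffOn ℝ ∞ (pd a F) M :=
  (hF.fderiv_of_isOpen hMo (m := ∞) (by simp)).clm_apply contDiffOn_const

theorem pd_pd_eq_fderiv_fderiv (hMo : IsOpen M) (hF : ContDiffOn ℝ ∞ F M) (hp : p ∈ M)
    (a b : Base) : pd a (pd b F) p = fderiv ℝ (fderiv ℝ F) p a b := by
  have h := (differentiableAt_fderiv_of_contDiffOn hMo hF hp).hasFDerivAt.clm_apply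
    (hasFDerivAt_const b p)
  rw [pd, show pd b F = fun q => fderiv ℝ F q b from rfl, h.fderiv]
  simp

theorem pd_comm (hMo : IsOpen M) (hF : ContDiffOn ℝ ∞ F M) (hp : p ∈ M) (a b : Base) :
    pd a (pd b F) p = pd b (pd a F) p := by
  rw [pd_pd_eq_fderiv_fderiv hMo hF hp, pd_pd_eq_fderiv_fderiv hMo hF hp]
  exact ((hF.contDiffAt (hMo.mem_nhds hp)).isSymmSndFDerivAt
    (by simpa using WithTop.coe_le_coe.2 (le_top : (2 : ℕ∞) ≤ ⊤))) a b

theorem pd_congr (hMo : IsOpen M) (h : ∀ q ∈ M, F q = G q) (hp : p ∈ M) (a : Base) :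
    pd a F p = pd a G p := by
  have : F =ᶠ[nhds p] G := Filter.eventuallyEq_of_mem (hMo.mem_nhds hp) h
  rw [pd, pd, this.fderiv_eq]

theorem pd_eq_zero (hMo : IsOpen M) (h : ∀ q ∈ M, F q = 0) (hp : p ∈ M) (a : Base) :
    pd a F p = 0 := by
  rw [pd_congr hMo (G := fun _ => 0) h hp]; simp [pd]

theorem pd_add_dir (a b : Base) (F : Base → ℝ) (p : Base) :
    pd (a + b) F p = pd a F p + pd b F p := map_add _ _ _

theorem pd_smul_dir (t : ℝ) (a : Base) (F : Base → ℝ) (p : Base) :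
    pd (t • a) F p = t * pd a F p := map_smul _ _ _

theorem pd_zero_dir (F : Base → ℝ) (p : Base) : pd 0 F p = 0 := map_zero _

theorem pd_mul (hF : DifferentiableAt ℝ F p) (hG : DifferentiableAt ℝ G p) (a : Base) :
    pd a (fun q => F q * G q) p = F p * pd a G p + pd a F p * G p := by
  simp only [pd]
  rw [fderiv_fun_mul hF hG]; simp [mul_comm]

theorem pd_add (hF : DifferentiableAt ℝ F p) (hG : DifferentiableAt ℝ G p) (a : Base) :
    pd a (fun q => F q + G q) p = pd a F p + pd a G p := by
  simp only [pd]
  rw [fderiv_fun_add hF hG]; simp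

theorem pd_sub (hF : DifferentiableAt ℝ F p) (hG : DifferentiableAt ℝ G p) (a : Base) :
    pd a (fun q => F q - G q) p = pd a F p - pd a G p := by
  simp only [pd]
  rw [fderiv_fun_sub hF hG]; simp

theorem pd_const_mul (c : ℝ) (hF : DifferentiableAt ℝ F p) (a : Base) :
    pd a (fun q => c * F q) p = c * pd a F p := by
  simp only [pd]
  rw [fderiv_const_mul hF]; simp

/-- The projection to a dependent variable. -/
def depProj (β : Fin 4) : Base →L[ℝ] ℝ :=
  (ContinuousLinearMap.proj β).comp (ContinuousLinearMap.snd ℝ _ _)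

theorem pd_dep (a : Base) (β : Fin 4) (p : Base) : pd a (fun q => q.2 β) p = a.2 β := by
  rw [pd, (depProj β).hasFDerivAt.fderiv (f := fun q : Base => q.2 β)]; rfl

theorem differentiableAt_dep (β : Fin 4) (p : Base) :
    DifferentiableAt ℝ (fun q : Base => q.2 β) p := (depProj β).differentiableAt

end DirectionalDerivatives

/-! ### Explicit form of the equations -/

/-- The differential of `K = e² / ε`. -/
def dK (p a : Base) : ℝ := 2 * (e p / ε p) * a.2 0 - (e p / ε p) ^ 2 * a.2 1

theorem hasFDerivAt_K {p : Base} (hp : ε p ≠ 0) :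
    HasFDerivAt K ((2 * (e p / ε p)) • depProj 0 - ((e p / ε p) ^ 2) • depProj 1) p := by
  have h0 : HasFDerivAt e (depProj 0) p := (depProj 0).hasFDerivAt
  have h1 : HasFDerivAt ε (depProj 1) p := (depProj 1).hasFDerivAt
  have h := (h0.pow 2).mul ((hasDerivAt_inv hp).comp_hasFDerivAt p h1)
  have hK : K = (e ^ 2 * (fun y => y⁻¹) ∘ ε) := by
    ext q; simp [K, div_eq_mul_inv]
  rw [hK]
  refine h.congr_fderiv ?_
  ext a <;> simp <;> field_simp <;> ring

/-- The direction in the space of variables of the total derivative `D_i`. -/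
def dir (u : Fin 4 → Fin 3 → ℝ) (i : Fin 3) : Base := (Pi.single i 1, fun β => u β i)

theorem totalDeriv₁_flux (C : ℝ) (α : Fin 4) (i k : Fin 3) {j : Jet2} (hj : ε j.1.1 ≠ 0) :
    totalDeriv₁ (fun q => C * K q.1 * q.2 α i) k j =
      C * (dK j.1.1 (dir j.1.2 k) * j.1.2 α i + K j.1.1 * j.2 α i k) := by
  have hK : HasFDerivAt (fun q : Jet1 => K q.1) _ j.1 :=
    (hasFDerivAt_K hj).comp j.1 hasFDerivAt_fst
  have hu : HasFDerivAt (fun q : Jet1 => q.2 α i)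
      ((ContinuousLinearMap.proj i).comp ((ContinuousLinearMap.proj (R := ℝ)
        (φ := fun _ : Fin 4 => Fin 3 → ℝ) α).comp (ContinuousLinearMap.snd ℝ _ _))) j.1 :=
    ((ContinuousLinearMap.proj (R := ℝ) (φ := fun _ : Fin 3 => ℝ) i).comp
      ((ContinuousLinearMap.proj (R := ℝ) (φ := fun _ : Fin 4 => Fin 3 → ℝ) α).comp
        (ContinuousLinearMap.snd ℝ Base _))).hasFDerivAt
  rw [totalDeriv₁]
  refine (congrArg (fun L : Jet1 →L[ℝ] ℝ => L _) ((hK.const_mul C).mul hu).fderiv).trans ?_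
  simp [dK, dir, depProj]
  ring

theorem totalDeriv₁_K (C : ℝ) (k : Fin 3) {j : Jet2} (hj : ε j.1.1 ≠ 0) :
    totalDeriv₁ (fun q => C * K q.1) k j = C * dK j.1.1 (dir j.1.2 k) := by
  have hK : HasFDerivAt (fun q : Jet1 => K q.1) _ j.1 :=
    (hasFDerivAt_K hj).comp j.1 hasFDerivAt_fst
  rw [totalDeriv₁, (hK.const_mul C).fderiv]
  simp [dK, dir, depProj]

/-- The diffusion constants of the four equations. -/
def diffConst : Fin 4 → ℝ := ![Ce, Cε, Cρ, C₁ρ]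

/-- The explicit form of the diffusion term without its constant. -/
def diffTerm (α : Fin 4) (j : Jet2) : ℝ :=
  dK j.1.1 (dir j.1.2 1) * j.1.2 α 1 + dK j.1.1 (dir j.1.2 2) * j.1.2 α 2
    + K j.1.1 * (j.2 α 1 1 + j.2 α 2 2)

/-- The source terms of the four equations. -/
def source : Fin 4 → Jet1 → ℝ :=
  ![fun j => - ε j.1,
    fun j => - (Cε₂ * (ε j.1 ^ 2 / e j.1)),
    fun j => - (Cρ * dK j.1 (dir j.2 2)),
    fun j => 2 * Cρ * K j.1 * (j.2 2 1) ^ 2 + 2 * Cρ * K j.1 * (j.2 2 2 - 1) ^ 2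
        - CT * (R j.1 * ε j.1 / e j.1)]

/-- Only `ε ≠ 0` is needed: `K` is the only quotient that gets differentiated, while the division by
`e` in the sources is carried over unchanged. -/
theorem Δ_eq (ν : Fin 4) {j : Jet2} (hj : ε j.1.1 ≠ 0) :
    Δ ν j = j.1.2 ν 0 - (diffConst ν * diffTerm ν j + source ν j.1) := by
  fin_cases ν <;>
    simp [Δ, diffusion, totalDeriv₁_flux, totalDeriv₁_K, hj, diffConst, diffTerm, source, U₀] <;>
    ring

/-- The differential of `D_i K`, where `u` and `du` are the values of the first derivatives of the
dependent variables in the `i`-th direction and of their variations. -/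
def ddK (p dp : Base) (u du : Fin 4 → ℝ) : ℝ :=
  2 * ((dp.2 0 - e p / ε p * dp.2 1) / ε p) * (u 0 - e p / ε p * u 1) + dK p (0, du)

/-- The differentials of the source terms. -/
def dsource : Fin 4 → Jet1 → Jet1 → ℝ :=
  ![fun _ d => - d.1.2 1,
    fun j d => - (Cε₂ * (2 * (ε j.1 / e j.1) * d.1.2 1 - (ε j.1 / e j.1) ^ 2 * d.1.2 0)),
    fun j d => - (Cρ * ddK j.1 d.1 (fun β => j.2 β 2) (fun β => d.2 β 2)),
    fun j d => 2 * Cρ * (dK j.1 d.1 * ((j.2 2 1) ^ 2 + (j.2 2 2 - 1) ^ 2)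
        + 2 * K j.1 * (j.2 2 1 * d.2 2 1 + (j.2 2 2 - 1) * d.2 2 2))
        - CT * ((d.1.2 3 * ε j.1 + R j.1 * d.1.2 1) / e j.1
          - R j.1 * ε j.1 * d.1.2 0 / e j.1 ^ 2)]

/-- The differential of the diffusion term. -/
def ddiffTerm (α : Fin 4) (j d : Jet2) : ℝ :=
  ddK j.1.1 d.1.1 (fun β => j.1.2 β 1) (fun β => d.1.2 β 1) * j.1.2 α 1
    + dK j.1.1 (dir j.1.2 1) * d.1.2 α 1
    + ddK j.1.1 d.1.1 (fun β => j.1.2 β 2) (fun β => d.1.2 β 2) * j.1.2 α 2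
    + dK j.1.1 (dir j.1.2 2) * d.1.2 α 2
    + dK j.1.1 d.1.1 * (j.2 α 1 1 + j.2 α 2 2) + K j.1.1 * (d.2 α 1 1 + d.2 α 2 2)

/-! ### Differentials of the four equations on the second jet space. -/

section Coordinates

variable (j : Jet2)

/-- The projection to the space of variables. -/
def baseProj : Jet2 →L[ℝ] Base :=
  (ContinuousLinearMap.fst ℝ Base _).comp (ContinuousLinearMap.fst ℝ Jet1 _)

theorem hasFDerivAt_base : HasFDerivAt (fun j : Jet2 => j.1.1) baseProj j :=
  baseProj.hasFDerivAt

theorem hasFDerivAt_dep (β : Fin 4) :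
    HasFDerivAt (fun j : Jet2 => j.1.1.2 β) ((depProj β).comp baseProj) j :=
  ((depProj β).comp baseProj).hasFDerivAt

/-- The projection to a first derivative. -/
def jetProj₁ (β : Fin 4) (i : Fin 3) : Jet2 →L[ℝ] ℝ :=
  (ContinuousLinearMap.proj i).comp ((ContinuousLinearMap.proj (R := ℝ)
    (φ := fun _ : Fin 4 => Fin 3 → ℝ) β).comp
      ((ContinuousLinearMap.snd ℝ Base _).comp (ContinuousLinearMap.fst ℝ Jet1 _)))

theorem hasFDerivAt_jet₁ (β : Fin 4) (i : Fin 3) :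
    HasFDerivAt (fun j : Jet2 => j.1.2 β i) (jetProj₁ β i) j :=
  ContinuousLinearMap.hasFDerivAt (jetProj₁ β i)

/-- The projection to a second derivative. -/
def jetProj₂ (β : Fin 4) (i k : Fin 3) : Jet2 →L[ℝ] ℝ :=
  (ContinuousLinearMap.proj k).comp ((ContinuousLinearMap.proj (R := ℝ)
    (φ := fun _ : Fin 3 => Fin 3 → ℝ) i).comp ((ContinuousLinearMap.proj (R := ℝ)
    (φ := fun _ : Fin 4 => Fin 3 → Fin 3 → ℝ) β).comp (ContinuousLinearMap.snd ℝ Jet1 _)))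

theorem hasFDerivAt_jet₂ (β : Fin 4) (i k : Fin 3) :
    HasFDerivAt (fun j : Jet2 => j.2 β i k) (jetProj₂ β i k) j :=
  ContinuousLinearMap.hasFDerivAt (jetProj₂ β i k)

variable {j}

theorem hasFDerivAt_quot {p : Base} (hp : ε p ≠ 0) : HasFDerivAt (fun p => e p / ε p)
    ((ε p)⁻¹ • depProj 0 - (e p / ε p ^ 2) • depProj 1) p := by
  have h0 : HasFDerivAt e (depProj 0) p := (depProj 0).hasFDerivAt
  have h1 : HasFDerivAt ε (depProj 1) p := (depProj 1).hasFDerivAt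
  have h := h0.mul ((hasDerivAt_inv hp).comp_hasFDerivAt p h1)
  refine (h.congr_fderiv ?_)
  ext a <;> simp [div_eq_mul_inv] <;> ring

/-- The derivative is packaged as an unnamed `L` with a formula for its values, so later product
rules can use the formula without unfolding `L`. -/
theorem hasFDerivAt_totalK (hj : ε j.1.1 ≠ 0) (i : Fin 3) :
    ∃ L : Jet2 →L[ℝ] ℝ, HasFDerivAt (fun j : Jet2 => dK j.1.1 (dir j.1.2 i)) L j ∧
      ∀ d, L d = ddK j.1.1 d.1.1 (fun β => j.1.2 β i) (fun β => d.1.2 β i) := by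
  have hr : HasFDerivAt (fun j : Jet2 => e j.1.1 / ε j.1.1) _ j :=
    HasFDerivAt.comp (g := fun p : Base => e p / ε p) j (hasFDerivAt_quot hj) (hasFDerivAt_base j)
  have h := ((hr.const_mul 2).mul (hasFDerivAt_jet₁ j 0 i)).sub
    ((hr.pow 2).mul (hasFDerivAt_jet₁ j 1 i))
  refine ⟨_, h, fun d => ?_⟩
  simp [ddK, dK, depProj, jetProj₁, baseProj]
  field_simp
  ring

theorem hasFDerivAt_K_jet (hj : ε j.1.1 ≠ 0) :
    ∃ L : Jet2 →L[ℝ] ℝ, HasFDerivAt (fun j : Jet2 => K j.1.1) L j ∧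
      ∀ d, L d = dK j.1.1 d.1.1 := by
  refine ⟨_, HasFDerivAt.comp (g := K) j (hasFDerivAt_K hj) (hasFDerivAt_base j), fun d => ?_⟩
  simp [dK, depProj, baseProj]

theorem hasFDerivAt_diffTerm (hj : ε j.1.1 ≠ 0) (α : Fin 4) :
    ∃ L : Jet2 →L[ℝ] ℝ, HasFDerivAt (diffTerm α) L j ∧ ∀ d, L d = ddiffTerm α j d := by
  obtain ⟨L1, h1, hL1⟩ := hasFDerivAt_totalK hj 1
  obtain ⟨L2, h2, hL2⟩ := hasFDerivAt_totalK hj 2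
  obtain ⟨L3, h3, hL3⟩ := hasFDerivAt_K_jet hj
  refine ⟨_, ((h1.mul (hasFDerivAt_jet₁ j α 1)).add (h2.mul (hasFDerivAt_jet₁ j α 2))).add
    (h3.mul ((hasFDerivAt_jet₂ j α 1 1).add (hasFDerivAt_jet₂ j α 2 2))), fun d => ?_⟩
  simp [hL1, hL2, hL3, ddiffTerm, jetProj₁, jetProj₂]
  ring

theorem hasFDerivAt_source (hj : ε j.1.1 ≠ 0) (hj' : e j.1.1 ≠ 0) (ν : Fin 4) :
    ∃ L : Jet2 →L[ℝ] ℝ, HasFDerivAt (fun j : Jet2 => source ν j.1) L j ∧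
      ∀ d, L d = dsource ν j.1 d.1 := by
  have he := hasFDerivAt_dep j 0
  have hε := hasFDerivAt_dep j 1
  have hR := hasFDerivAt_dep j 3
  have hie := (hasDerivAt_inv hj').comp_hasFDerivAt j he
  fin_cases ν
  · exact ⟨_, hε.neg, fun d => by simp [dsource, depProj, baseProj]⟩
  · refine ⟨_, (((hε.pow 2).mul hie).const_mul Cε₂).neg, fun d => ?_⟩
    simp [dsource, depProj, baseProj]
    simp only [e, ε] at *
    field_simp
    ring
  · obtain ⟨L2, h2, hL2⟩ := hasFDerivAt_totalK hj 2
    refine ⟨_, (h2.const_mul Cρ).neg, fun d => ?_⟩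
    simp [dsource, hL2]
  · obtain ⟨L3, h3, hL3⟩ := hasFDerivAt_K_jet hj
    refine ⟨_, (((h3.const_mul (2 * Cρ)).mul ((hasFDerivAt_jet₁ j 2 1).pow 2)).add
      ((h3.const_mul (2 * Cρ)).mul (((hasFDerivAt_jet₁ j 2 2).sub_const 1).pow 2))).sub
        (((hR.mul hε).mul hie).const_mul CT), fun d => ?_⟩
    simp [dsource, hL3, depProj, jetProj₁, baseProj]
    simp only [e, ε, R] at *
    field_simp
    ring

theorem fderiv_Δ (hj : j.1.1 ∈ domain) (ν : Fin 4) (d : Jet2) :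
    fderiv ℝ (Δ ν) j d =
      d.1.2 ν 0 - (diffConst ν * ddiffTerm ν j d + dsource ν j.1 d.1) := by
  obtain ⟨L1, h1, hL1⟩ := hasFDerivAt_diffTerm hj.2 ν
  obtain ⟨L2, h2, hL2⟩ := hasFDerivAt_source hj.2 hj.1 ν
  have h := (hasFDerivAt_jet₁ j ν 0).sub ((h1.const_mul (diffConst ν)).add h2)
  -- The explicit form holds only where `ε ≠ 0`; this is an open condition, which suffices for the
  -- derivative.
  have hev : Δ ν =ᶠ[nhds j]
      fun j => j.1.2 ν 0 - (diffConst ν * diffTerm ν j + source ν j.1) := by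
    have hc : ContinuousAt (fun j : Jet2 => j.1.1.2 1) j := (hasFDerivAt_dep j 1).continuousAt
    filter_upwards [hc.eventually_ne hj.2] with q hq using Δ_eq ν hq
  rw [hev.fderiv_eq]
  refine (congrArg (fun L : Jet2 →L[ℝ] ℝ => L d) h.fderiv).trans ?_
  simp [hL1, hL2, jetProj₁]

end Coordinates

section

/-! ### Explicit form of the prolongation -/

/-- The coefficient `ξ^l` of a vector field. -/
def ξ (v : Base → Base) (l : Fin 3) : Base → ℝ := fun p => (v p).1 l

/-- The coefficient `φ^α` of a vector field. -/
def φ (v : Base → Base) (α : Fin 4) : Base → ℝ := fun p => (v p).2 α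

section Prolongation

variable {M : Set Base} {v : Base → Base} {F : Base → ℝ} {j : Jet2}

theorem contDiffOn_ξ (hv : ContDiffOn ℝ ∞ v M) (l : Fin 3) : ContDiffOn ℝ ∞ (ξ v l) M :=
  contDiffOn_pi.1 hv.fst l

theorem contDiffOn_φ (hv : ContDiffOn ℝ ∞ v M) (α : Fin 4) : ContDiffOn ℝ ∞ (φ v α) M :=
  contDiffOn_pi.1 hv.snd α

theorem totalDeriv₀_eq (F : Base → ℝ) (i : Fin 3) (j : Jet1) :
    totalDeriv₀ F i j = pd (dir j.2 i) F j.1 := rfl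

theorem prol₁_eq (v : Base → Base) (α : Fin 4) (i : Fin 3) (j : Jet1) :
    prol₁ v α i j = pd (dir j.2 i) (φ v α) j.1 - ∑ l, pd (dir j.2 i) (ξ v l) j.1 * j.2 α l := rfl

/-- The direction of the second derivatives in a total derivative. -/
def dir₂ (h : Fin 4 → Fin 3 → Fin 3 → ℝ) (i k : Fin 3) : Base := (0, fun β => h β i k)

/-- The projection `u ↦ (u^β_i)_β`. -/
def columnProj (i : Fin 3) : (Fin 4 → Fin 3 → ℝ) →L[ℝ] (Fin 4 → ℝ) :=
  ContinuousLinearMap.pi fun β => (ContinuousLinearMap.proj i).comp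
    (ContinuousLinearMap.proj (R := ℝ) (φ := fun _ : Fin 4 => Fin 3 → ℝ) β)

theorem hasFDerivAt_dir (i : Fin 3) (q : Jet1) :
    HasFDerivAt (fun q : Jet1 => dir q.2 i)
      ((ContinuousLinearMap.inr ℝ (Fin 3 → ℝ) (Fin 4 → ℝ)).comp
        ((columnProj i).comp (ContinuousLinearMap.snd ℝ Base _))) q := by
  have h := (((ContinuousLinearMap.inr ℝ (Fin 3 → ℝ) (Fin 4 → ℝ)).comp
        ((columnProj i).comp (ContinuousLinearMap.snd ℝ Base _))).hasFDerivAt (x := q)).const_add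
          ((Pi.single i 1, 0) : Base)
  refine h.congr_of_eventuallyEq (Filter.Eventually.of_forall fun q => ?_)
  ext k <;> simp [dir, columnProj]

/-- The direction `dir` itself depends on the jet: the product rule gives a second derivative with
both directions frozen, plus a first derivative along the variation `dir₂` of the direction. -/
theorem hasFDerivAt_totalDeriv₀ (hMo : IsOpen M) (hF : ContDiffOn ℝ ∞ F M) (hj : j.1.1 ∈ M)
    (i : Fin 3) : ∃ L : Jet1 →L[ℝ] ℝ, HasFDerivAt (totalDeriv₀ F i) L j.1 ∧
      ∀ k, L (dir j.1.2 k, fun β m => j.2 β m k) =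
        pd (dir j.1.2 k) (pd (dir j.1.2 i) F) j.1.1 + pd (dir₂ j.2 i k) F j.1.1 := by
  have h1 : HasFDerivAt (fun q : Jet1 => fderiv ℝ F q.1) _ j.1 :=
    HasFDerivAt.comp (g := fderiv ℝ F) j.1
      (differentiableAt_fderiv_of_contDiffOn hMo hF hj).hasFDerivAt hasFDerivAt_fst
  refine ⟨_, h1.clm_apply (hasFDerivAt_dir i j.1), fun k => ?_⟩
  rw [pd_pd_eq_fderiv_fderiv hMo hF hj]
  simp only [pd, add_apply, ContinuousLinearMap.comp_apply,
    ContinuousLinearMap.flip_apply, ContinuousLinearMap.coe_fst', ContinuousLinearMap.coe_snd']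
  exact add_comm _ _

theorem prol₂_eq (hMo : IsOpen M) (hv : ContDiffOn ℝ ∞ v M) (hj : j.1.1 ∈ M) (α : Fin 4)
    (i k : Fin 3) :
    prol₂ v α i k j =
      pd (dir j.1.2 k) (pd (dir j.1.2 i) (φ v α)) j.1.1 + pd (dir₂ j.2 i k) (φ v α) j.1.1
      - ∑ l, ((pd (dir j.1.2 k) (pd (dir j.1.2 i) (ξ v l)) j.1.1
          + pd (dir₂ j.2 i k) (ξ v l) j.1.1) * j.1.2 α l
        + pd (dir j.1.2 i) (ξ v l) j.1.1 * j.2 α l k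
        + pd (dir j.1.2 k) (ξ v l) j.1.1 * j.2 α i l) := by
  obtain ⟨L, hL, hL'⟩ := hasFDerivAt_totalDeriv₀ hMo (contDiffOn_φ hv α) hj i
  choose N hN hN' using fun l => hasFDerivAt_totalDeriv₀ hMo (contDiffOn_ξ hv l) hj i
  have hu : ∀ l, HasFDerivAt (fun q : Jet1 => q.2 α l)
      ((ContinuousLinearMap.proj l).comp ((ContinuousLinearMap.proj (R := ℝ)
        (φ := fun _ : Fin 4 => Fin 3 → ℝ) α).comp (ContinuousLinearMap.snd ℝ _ _))) j.1 := fun l =>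
    ((ContinuousLinearMap.proj (R := ℝ) (φ := fun _ : Fin 3 => ℝ) l).comp
      ((ContinuousLinearMap.proj (R := ℝ) (φ := fun _ : Fin 4 => Fin 3 → ℝ) α).comp
        (ContinuousLinearMap.snd ℝ Base _))).hasFDerivAt
  have h := hL.sub (HasFDerivAt.fun_sum (u := Finset.univ) fun l _ => (hN l).mul (hu l))
  have h2 : totalDeriv₁ (prol₁ v α i) k j = _ :=
    congrArg (fun L : Jet1 →L[ℝ] ℝ => L (dir j.1.2 k, fun β m => j.2 β m k)) h.fderiv
  rw [prol₂, h2]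
  simp only [sub_apply, hL', sum_apply,
    add_apply, smul_apply, hN', smul_eq_mul,
    ContinuousLinearMap.comp_apply, ContinuousLinearMap.coe_snd', ContinuousLinearMap.proj_apply,
    totalDeriv₀_eq]
  rw [sub_sub, ← Finset.sum_add_distrib]
  refine congrArg₂ _ rfl (Finset.sum_congr rfl fun l _ => ?_)
  rw [show (fun p => (v p).1 l) = ξ v l from rfl]
  ring

end Prolongation

end

section

/-! ### The determining equations -/

/-- The coordinate direction of an independent variable. -/
def ex (i : Fin 3) : Base := (Pi.single i 1, 0)

/-- The direction of the dependent variables with components `η`. -/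
def du (η : Fin 4 → ℝ) : Base := (0, η)

/-- First derivatives with prescribed columns. -/
def cols (c a b : Fin 4 → ℝ) : Fin 4 → Fin 3 → ℝ := fun β => ![c β, a β, b β]

/-- The `x`-derivatives that solve the model, where `a`, `b` are the first derivatives with respect
to `y`, `z` and `P`, `Q` are the pure second derivatives with respect to `y`, `z`. -/
def sol (p : Base) (a b P Q : Fin 4 → ℝ) (ν : Fin 4) : ℝ :=
  diffConst ν * (dK p (du a) * a ν + dK p (du b) * b ν + K p * (P ν + Q ν))
    + source ν (p, cols 0 a b)

/-- The second derivatives with `xx`-, `xy`-, `xz`-, `yy`-, `zz`-, `yz`-components `o`, `m`, `n`, `P`,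
`Q`, `T`. -/
def hess (o m n P Q T : Fin 4 → ℝ) : Fin 4 → Fin 3 → Fin 3 → ℝ :=
  fun β => ![![o β, m β, n β], ![m β, P β, T β], ![n β, T β, Q β]]

/-- A jet that solves the model. -/
def solJet (p : Base) (a b m n P Q T : Fin 4 → ℝ) : Jet2 :=
  ((p, cols (sol p a b P Q) a b), hess 0 m n P Q T)

variable {M : Set Base} {v : Base → Base} {p : Base}

theorem dK_dir (p : Base) (u : Fin 4 → Fin 3 → ℝ) (i : Fin 3) :
    dK p (dir u i) = dK p (du fun β => u β i) := rfl

theorem dir_eq (u : Fin 4 → Fin 3 → ℝ) (i : Fin 3) : dir u i = ex i + du (fun β => u β i) := by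
  simp [dir, ex, du]

theorem isJet_solJet (p : Base) (a b m n P Q T : Fin 4 → ℝ) : IsJet (solJet p a b m n P Q T) := by
  intro α i k
  fin_cases i <;> fin_cases k <;> simp [solJet, hess]

/-- No source term contains an `x`-derivative; this is what makes the definition of `sol`
non-circular. -/
theorem source_cols (p : Base) (c a b : Fin 4 → ℝ) (ν : Fin 4) :
    source ν (p, cols c a b) = source ν (p, cols 0 a b) := by
  fin_cases ν <;> simp [source, cols, dK_dir]

theorem dsource_cols (p dp : Base) (c a b C A B : Fin 4 → ℝ) (ν : Fin 4) :
    dsource ν (p, cols c a b) (dp, cols C A B) = dsource ν (p, cols 0 a b) (dp, cols 0 A B) := by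
  fin_cases ν <;> simp [dsource, cols]

/-- The second derivatives involving `x` and the mixed `yz`-derivative do not enter the equations,
so `m`, `n`, `T` are arbitrary. -/
theorem Δ_solJet (hp : p ∈ domain) (a b m n P Q T : Fin 4 → ℝ) (ν : Fin 4) :
    Δ ν (solJet p a b m n P Q T) = 0 := by
  rw [Δ_eq ν (j := solJet p a b m n P Q T) hp.2, solJet, source_cols]
  simp [sol, cols, diffTerm, hess, dK_dir]

/-- The components `(φ^α_i)_α` of the first prolongation, where `w` is the direction of the total
derivative `D_i` and `c`, `a`, `b` are the columns of the first derivatives. -/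
def pr₁ (v : Base → Base) (p w : Base) (c a b : Fin 4 → ℝ) (α : Fin 4) : ℝ :=
  pd w (φ v α) p - (pd w (ξ v 0) p * c α + pd w (ξ v 1) p * a α + pd w (ξ v 2) p * b α)

/-- The components `(φ^α_{ii})_α` of the second prolongation, where `w` is the direction of the
total derivative `D_i`, the second derivatives involving `i` are `m`, `P`, `Q`, and `H` is the one
among them for the pure derivative. -/
def pr₂ (v : Base → Base) (p w : Base) (c a b m P Q H : Fin 4 → ℝ) (α : Fin 4) : ℝ :=
  pd w (pd w (φ v α)) p + pd (du H) (φ v α) p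
    - ((pd w (pd w (ξ v 0)) p + pd (du H) (ξ v 0) p) * c α
      + (pd w (pd w (ξ v 1)) p + pd (du H) (ξ v 1) p) * a α
      + (pd w (pd w (ξ v 2)) p + pd (du H) (ξ v 2) p) * b α
      + 2 * (pd w (ξ v 0) p * m α + pd w (ξ v 1) p * P α + pd w (ξ v 2) p * Q α))

theorem prol_cols (v : Base → Base) (p : Base) (c a b : Fin 4 → ℝ) :
    (fun α i => prol₁ v α i (p, cols c a b)) =
      cols (pr₁ v p (ex 0 + du c) c a b) (pr₁ v p (ex 1 + du a) c a b)
        (pr₁ v p (ex 2 + du b) c a b) := by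
  ext α i
  fin_cases i <;> simp [prol₁_eq, pr₁, Fin.sum_univ_three, dir_eq, cols]

theorem prol₂_hess_one (hMo : IsOpen M) (hv : ContDiffOn ℝ ∞ v M) (hp : p ∈ M)
    (c a b o m n P Q T : Fin 4 → ℝ) (α : Fin 4) :
    prol₂ v α 1 1 ((p, cols c a b), hess o m n P Q T) = pr₂ v p (ex 1 + du a) c a b m P T P α := by
  rw [prol₂_eq hMo hv (j := ((p, cols c a b), hess o m n P Q T)) hp]
  simp [pr₂, Fin.sum_univ_three, dir_eq, cols, dir₂, hess, ← du.eq_1]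
  ring

theorem prol₂_hess_two (hMo : IsOpen M) (hv : ContDiffOn ℝ ∞ v M) (hp : p ∈ M)
    (c a b o m n P Q T : Fin 4 → ℝ) (α : Fin 4) :
    prol₂ v α 2 2 ((p, cols c a b), hess o m n P Q T) = pr₂ v p (ex 2 + du b) c a b n T Q Q α := by
  rw [prol₂_eq hMo hv (j := ((p, cols c a b), hess o m n P Q T)) hp]
  simp [pr₂, Fin.sum_univ_three, dir_eq, cols, dir₂, hess, ← du.eq_1]
  ring

/-- The differential of the `ν`-th equation applied to the prolongation of `v`. -/
theorem fderiv_Δ_prolongation (hMo : IsOpen M) (hM : M ⊆ domain) (hv : ContDiffOn ℝ ∞ v M)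
    (hp : p ∈ M) (c a b o m n P Q T : Fin 4 → ℝ) (ν : Fin 4) {j : Jet2}
    (hj : j = ((p, cols c a b), hess o m n P Q T))
    {A B : Fin 4 → ℝ} (hA : pr₁ v p (ex 1 + du a) c a b = A)
    (hB : pr₁ v p (ex 2 + du b) c a b = B) :
    fderiv ℝ (Δ ν) j (prolongation v j) =
      pr₁ v p (ex 0 + du c) c a b ν - (diffConst ν *
        (ddK p (v p) a A * a ν + dK p (du a) * A ν + ddK p (v p) b B * b ν + dK p (du b) * B ν
          + dK p (v p) * (P ν + Q ν)
          + K p * (pr₂ v p (ex 1 + du a) c a b m P T P ν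
            + pr₂ v p (ex 2 + du b) c a b n T Q Q ν))
        + dsource ν (p, cols 0 a b) (v p, cols 0 A B)) := by
  subst hj hA hB
  rw [fderiv_Δ (hM hp), ← prol₂_hess_one hMo hv hp c a b o m n P Q T,
    ← prol₂_hess_two hMo hv hp c a b o m n P Q T, prolongation, prol_cols, dsource_cols]
  simp [ddiffTerm, cols, hess, dK_dir]

/-- The master identity, in which all of `a, b, m, n, P, Q, T` are free. The variables `c`, `A`, `B`
with their equations let simplified forms of these columns be substituted directly. -/
theorem IsInfinitesimalSymmetry.determining (hv : IsInfinitesimalSymmetry M v) (hMo : IsOpen M)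
    (hM : M ⊆ domain) (hp : p ∈ M) (a b m n P Q T : Fin 4 → ℝ) (ν : Fin 4)
    {c A B : Fin 4 → ℝ} (hc : sol p a b P Q = c) (hA : pr₁ v p (ex 1 + du a) c a b = A)
    (hB : pr₁ v p (ex 2 + du b) c a b = B) :
      pr₁ v p (ex 0 + du c) c a b ν = diffConst ν *
        (ddK p (v p) a A * a ν + dK p (du a) * A ν + ddK p (v p) b B * b ν + dK p (du b) * B ν
          + dK p (v p) * (P ν + Q ν)
          + K p * (pr₂ v p (ex 1 + du a) c a b m P T P ν
            + pr₂ v p (ex 2 + du b) c a b n T Q Q ν))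
        + dsource ν (p, cols 0 a b) (v p, cols 0 A B) := by
  have h := hv.2 (solJet p a b m n P Q T) (isJet_solJet p a b m n P Q T) hp
    (fun ν => Δ_solJet (hM hp) a b m n P Q T ν) ν
  subst hc
  rw [fderiv_Δ_prolongation hMo hM hv.1 hp (sol p a b P Q) a b 0 m n P Q T ν
    (j := solJet p a b m n P Q T) rfl hA hB] at h
  linarith

theorem K_ne_zero (hp : p ∈ domain) : K p ≠ 0 :=
  div_ne_zero (pow_ne_zero 2 hp.1) hp.2

theorem diffConst_pos (ν : Fin 4) : 0 < diffConst ν := by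
  fin_cases ν <;> norm_num [diffConst, Ce, Cε, Cρ, C₁ρ, δ]

/-- This is what decouples the components `φ^α`; among the properties of the numerical constants it
is the decisive one, besides positivity and `CT ≠ 0`. -/
theorem diffConst_injective : Function.Injective diffConst := by
  intro α β h
  fin_cases α <;> fin_cases β <;> first | rfl | norm_num [diffConst, Ce, Cε, Cρ, C₁ρ, δ] at h

/-- Neither `sol` nor the first prolongation sees `m`, `n`, `T`; they enter only through the terms
`(D_i ξ^l) u^α_{il}` of the second prolongation, which a difference of two instances isolates. -/
theorem IsInfinitesimalSymmetry.mixed (hv : IsInfinitesimalSymmetry M v) (hMo : IsOpen M)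
    (hM : M ⊆ domain) (hp : p ∈ M) (a b : Fin 4 → ℝ) (m n t : ℝ) :
    pd (ex 1 + du a) (ξ v 0) p * m + pd (ex 2 + du b) (ξ v 0) p * n
      + (pd (ex 1 + du a) (ξ v 2) p + pd (ex 2 + du b) (ξ v 1) p) * t = 0 := by
  have h1 := hv.determining hMo hM hp a b (fun _ => m) (fun _ => n) 0 0 (fun _ => t) 0 rfl rfl rfl
  have h0 := hv.determining hMo hM hp a b 0 0 0 0 0 0 rfl rfl rfl
  simp only [pr₂, Pi.zero_apply] at h1 h0
  have hC := (diffConst_pos 0).ne'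
  have hK := K_ne_zero (hM hp)
  have h : (2 * diffConst 0 * K p) * (pd (ex 1 + du a) (ξ v 0) p * m
      + pd (ex 2 + du b) (ξ v 0) p * n
      + (pd (ex 1 + du a) (ξ v 2) p + pd (ex 2 + du b) (ξ v 1) p) * t) = 0 := by
    linear_combination h1 - h0
  exact (mul_eq_zero.1 h).resolve_left (by positivity)

theorem du_zero : du 0 = 0 := rfl

/-- The components `ξ^l` do not depend on the dependent variables. -/
theorem IsInfinitesimalSymmetry.pd_du_ξ (hv : IsInfinitesimalSymmetry M v) (hMo : IsOpen M)
    (hM : M ⊆ domain) (hp : p ∈ M) (η : Fin 4 → ℝ) (l : Fin 3) : pd (du η) (ξ v l) p = 0 := by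
  fin_cases l
  -- The total derivative is the coordinate derivative plus the derivative along `η`; the instance
  -- with zero gradient removes the former.
  · have h1 := hv.mixed hMo hM hp η 0 1 0 0
    have h0 := hv.mixed hMo hM hp 0 0 1 0 0
    simp [pd_add_dir, du_zero] at *
    linarith
  · have h1 := hv.mixed hMo hM hp 0 η 0 0 1
    have h0 := hv.mixed hMo hM hp 0 0 0 0 1
    simp [pd_add_dir, du_zero] at *
    linarith
  · have h1 := hv.mixed hMo hM hp η 0 0 0 1
    have h0 := hv.mixed hMo hM hp 0 0 0 0 1
    simp [pd_add_dir, du_zero] at *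
    linarith

theorem IsInfinitesimalSymmetry.pd_one_ξ_zero (hv : IsInfinitesimalSymmetry M v) (hMo : IsOpen M)
    (hM : M ⊆ domain) (hp : p ∈ M) : pd (ex 1) (ξ v 0) p = 0 := by
  simpa [du_zero] using hv.mixed hMo hM hp 0 0 1 0 0

theorem IsInfinitesimalSymmetry.pd_two_ξ_zero (hv : IsInfinitesimalSymmetry M v) (hMo : IsOpen M)
    (hM : M ⊆ domain) (hp : p ∈ M) : pd (ex 2) (ξ v 0) p = 0 := by
  simpa [du_zero] using hv.mixed hMo hM hp 0 0 0 1 0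

/-- One of the two Cauchy–Riemann equations for `(ξ^1, ξ^2)`, from the coefficient of the mixed
`yz`-derivative. -/
theorem IsInfinitesimalSymmetry.pd_two_ξ_one (hv : IsInfinitesimalSymmetry M v) (hMo : IsOpen M)
    (hM : M ⊆ domain) (hp : p ∈ M) : pd (ex 2) (ξ v 1) p = - pd (ex 1) (ξ v 2) p := by
  have := hv.mixed hMo hM hp 0 0 0 0 1
  simp [du_zero] at this
  linarith

/-- The second derivatives of `ξ^l` do not depend on the first derivatives of the dependent
variables. -/
theorem IsInfinitesimalSymmetry.pd_pd_ξ (hv : IsInfinitesimalSymmetry M v) (hMo : IsOpen M)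
    (hM : M ⊆ domain) (hp : p ∈ M) (a : Base) (η ζ : Fin 4 → ℝ) (b : Base) (l : Fin 3) :
    pd (a + du η) (pd (b + du ζ) (ξ v l)) p = pd a (pd b (ξ v l)) p := by
  have hξ := contDiffOn_ξ hv.1 l
  rw [pd_congr hMo (G := pd b (ξ v l)) (fun q hq => by
    rw [pd_add_dir, hv.pd_du_ξ hMo hM hq, add_zero]) hp, pd_add_dir, pd_comm hMo hξ hp (du η),
    pd_eq_zero hMo (fun q hq => hv.pd_du_ξ hMo hM hq η l) hp, add_zero]

/-- The second derivatives of `ξ^0` with respect to `y` and `z` vanish. -/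
theorem IsInfinitesimalSymmetry.pd_pd_ξ_zero (hv : IsInfinitesimalSymmetry M v) (hMo : IsOpen M)
    (hM : M ⊆ domain) (hp : p ∈ M) (a : Base) :
    pd a (pd (ex 1) (ξ v 0)) p = 0 ∧ pd a (pd (ex 2) (ξ v 0)) p = 0 :=
  ⟨pd_eq_zero hMo (fun _ hq => hv.pd_one_ξ_zero hMo hM hq) hp a,
    pd_eq_zero hMo (fun _ hq => hv.pd_two_ξ_zero hMo hM hq) hp a⟩

end

section

/-! ### The second order part of the determining equations -/

/-- The coordinate direction of a dependent variable. -/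
def eu (α : Fin 4) : Base := du (Pi.single α 1)

variable {M : Set Base} {v : Base → Base} {p : Base}

theorem du_eq_sum (η : Fin 4 → ℝ) : du η = ∑ β, η β • eu β := by
  simp [du, eu, Fin.sum_univ_four, Prod.ext_iff, funext_iff, Fin.forall_fin_succ]

theorem pd_du_eq_sum (η : Fin 4 → ℝ) (F : Base → ℝ) (p : Base) :
    pd (du η) F p = ∑ β, η β * pd (eu β) F p := by
  rw [du_eq_sum, pd, map_sum]
  simp [pd]

theorem IsInfinitesimalSymmetry.pr₁_one (hv : IsInfinitesimalSymmetry M v) (hMo : IsOpen M)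
    (hM : M ⊆ domain) (hp : p ∈ M) (c a b : Fin 4 → ℝ) (α : Fin 4) :
    pr₁ v p (ex 1 + du a) c a b α = pd (ex 1) (φ v α) p + pd (du a) (φ v α) p
      - (pd (ex 1) (ξ v 1) p * a α + pd (ex 1) (ξ v 2) p * b α) := by
  simp [pr₁, pd_add_dir, hv.pd_du_ξ hMo hM hp, hv.pd_one_ξ_zero hMo hM hp]

theorem IsInfinitesimalSymmetry.pr₁_two (hv : IsInfinitesimalSymmetry M v) (hMo : IsOpen M)
    (hM : M ⊆ domain) (hp : p ∈ M) (c a b : Fin 4 → ℝ) (α : Fin 4) :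
    pr₁ v p (ex 2 + du b) c a b α = pd (ex 2) (φ v α) p + pd (du b) (φ v α) p
      - (- pd (ex 1) (ξ v 2) p * a α + pd (ex 2) (ξ v 2) p * b α) := by
  simp [pr₁, pd_add_dir, hv.pd_du_ξ hMo hM hp, hv.pd_two_ξ_zero hMo hM hp,
    hv.pd_two_ξ_one hMo hM hp]

/-- The determining equations for jets without mixed second derivatives. -/
theorem IsInfinitesimalSymmetry.reduced (hv : IsInfinitesimalSymmetry M v) (hMo : IsOpen M)
    (hM : M ⊆ domain) (hp : p ∈ M) (a b P Q : Fin 4 → ℝ) (ν : Fin 4) :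
    pd (ex 0) (φ v ν) p + pd (du (sol p a b P Q)) (φ v ν) p
      - (pd (ex 0) (ξ v 0) p * sol p a b P Q ν + pd (ex 0) (ξ v 1) p * a ν
        + pd (ex 0) (ξ v 2) p * b ν) =
      diffConst ν *
        (ddK p (v p) a (fun α => pd (ex 1) (φ v α) p + pd (du a) (φ v α) p
            - (pd (ex 1) (ξ v 1) p * a α + pd (ex 1) (ξ v 2) p * b α)) * a ν
          + dK p (du a) * (pd (ex 1) (φ v ν) p + pd (du a) (φ v ν) p
            - (pd (ex 1) (ξ v 1) p * a ν + pd (ex 1) (ξ v 2) p * b ν))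
          + ddK p (v p) b (fun α => pd (ex 2) (φ v α) p + pd (du b) (φ v α) p
            - (- pd (ex 1) (ξ v 2) p * a α + pd (ex 2) (ξ v 2) p * b α)) * b ν
          + dK p (du b) * (pd (ex 2) (φ v ν) p + pd (du b) (φ v ν) p
            - (- pd (ex 1) (ξ v 2) p * a ν + pd (ex 2) (ξ v 2) p * b ν))
          + dK p (v p) * (P ν + Q ν)
          + K p * (pd (ex 1 + du a) (pd (ex 1 + du a) (φ v ν)) p + pd (du P) (φ v ν) p
              + pd (ex 2 + du b) (pd (ex 2 + du b) (φ v ν)) p + pd (du Q) (φ v ν) p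
              - ((pd (ex 1) (pd (ex 1) (ξ v 1)) p + pd (ex 2) (pd (ex 2) (ξ v 1)) p) * a ν
                + (pd (ex 1) (pd (ex 1) (ξ v 2)) p + pd (ex 2) (pd (ex 2) (ξ v 2)) p) * b ν
                + 2 * (pd (ex 1) (ξ v 1) p * P ν + pd (ex 2) (ξ v 2) p * Q ν))))
        + dsource ν (p, cols 0 a b) (v p, cols 0
          (fun α => pd (ex 1) (φ v α) p + pd (du a) (φ v α) p
            - (pd (ex 1) (ξ v 1) p * a α + pd (ex 1) (ξ v 2) p * b α))
          (fun α => pd (ex 2) (φ v α) p + pd (du b) (φ v α) p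
            - (- pd (ex 1) (ξ v 2) p * a α + pd (ex 2) (ξ v 2) p * b α))) := by
  have h := hv.determining hMo hM hp a b 0 0 P Q 0 ν rfl
    (funext fun α => hv.pr₁_one hMo hM hp (sol p a b P Q) a b α)
    (funext fun α => hv.pr₁_two hMo hM hp (sol p a b P Q) a b α)
  have h0 := hv.pd_du_ξ hMo hM hp
  have h1 := (hv.pd_pd_ξ_zero hMo hM hp (ex 1)).1
  have h2 := (hv.pd_pd_ξ_zero hMo hM hp (ex 2)).2
  simp only [pr₁, pr₂, hv.pd_pd_ξ hMo hM hp, h1, h2, h0, pd_add_dir _ _ (ξ v _),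
    pd_add_dir (ex 0) _ (φ v _), hv.pd_one_ξ_zero hMo hM hp, hv.pd_two_ξ_zero hMo hM hp,
    Pi.zero_apply] at h
  linear_combination h

/-- At zero gradient, switch on `u^β_yy = s` and `u^β_zz = t` and subtract the instance without
them. The change of `u^β_x` carries `diffConst β`, while the diffusion in equation `ν` carries
`diffConst ν`. -/
theorem IsInfinitesimalSymmetry.second_order (hv : IsInfinitesimalSymmetry M v) (hMo : IsOpen M)
    (hM : M ⊆ domain) (hp : p ∈ M) (β ν : Fin 4) (s t : ℝ) :
    (diffConst β - diffConst ν) * K p * (s + t) * pd (eu β) (φ v ν) p =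
      diffConst ν * (Pi.single β 1 : Fin 4 → ℝ) ν * (dK p (v p) * (s + t)
        + K p * (pd (ex 0) (ξ v 0) p * (s + t)
          - 2 * (pd (ex 1) (ξ v 1) p * s + pd (ex 2) (ξ v 2) p * t))) := by
  have h1 := hv.reduced hMo hM hp 0 0 (s • Pi.single β 1) (t • Pi.single β 1) ν
  have h0 := hv.reduced hMo hM hp 0 0 0 0 ν
  have hs : ∀ γ, sol p 0 0 (s • Pi.single β 1) (t • Pi.single β 1) γ =
      sol p 0 0 0 0 γ + diffConst β * K p * (s + t) * (Pi.single β 1 : Fin 4 → ℝ) γ := by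
    intro γ
    rcases eq_or_ne γ β with rfl | h
    · simp [sol]; ring
    · simp [sol, h]
  have hd : du (sol p 0 0 (s • Pi.single β 1) (t • Pi.single β 1)) =
      du (sol p 0 0 0 0) + (diffConst β * K p * (s + t)) • eu β := by
    rw [eu, du, du, du]; ext γ
    · simp
    · simp [hs]
  have he : ∀ r : ℝ, du (r • Pi.single β 1) = r • eu β := by
    intro r; simp [eu, du]
  simp only [hd, he, hs, pd_add_dir _ _ (φ v _), pd_smul_dir, du_zero, pd_zero_dir,
    Pi.zero_apply, Pi.smul_apply, smul_eq_mul] at h1 h0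
  -- The `ξ^0_x` term arises with `diffConst β` but is stated with `diffConst ν`; it is present only
  -- for `β = ν`.
  have hδ : (diffConst β - diffConst ν) * (Pi.single β 1 : Fin 4 → ℝ) ν = 0 := by
    rcases eq_or_ne ν β with rfl | h
    · simp
    · simp [h]
  linear_combination h1 - h0 + K p * (s + t) * pd (ex 0) (ξ v 0) p * hδ

end

/-! ### Decoupling, conformality in `(y, z)` and linearity of `φ^0`, `φ^1`. -/

section

variable {M : Set Base} {v : Base → Base} {p : Base}

/-- The component `φ^α` depends on no dependent variable except the `α`-th one. -/
theorem IsInfinitesimalSymmetry.pd_eu_φ_of_ne (hv : IsInfinitesimalSymmetry M v) (hMo : IsOpen M)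
    (hM : M ⊆ domain) (hp : p ∈ M) {β ν : Fin 4} (h : ν ≠ β) : pd (eu β) (φ v ν) p = 0 := by
  have h1 := hv.second_order hMo hM hp β ν 1 0
  have hC : diffConst β - diffConst ν ≠ 0 := sub_ne_zero.2 fun h' => h (diffConst_injective h').symm
  have hK := K_ne_zero (hM hp)
  simpa [h, hC, hK] using h1

/-- Isotropy of the diffusion: `u_yy` and `u_zz` enter only through their sum, so both directions
must scale alike. This is the second Cauchy–Riemann equation. -/
theorem IsInfinitesimalSymmetry.pd_two_ξ_two (hv : IsInfinitesimalSymmetry M v) (hMo : IsOpen M)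
    (hM : M ⊆ domain) (hp : p ∈ M) : pd (ex 2) (ξ v 2) p = pd (ex 1) (ξ v 1) p := by
  have h1 := hv.second_order hMo hM hp 0 0 1 0
  have h2 := hv.second_order hMo hM hp 0 0 0 1
  have hK := K_ne_zero (hM hp)
  have hC := (diffConst_pos 0).ne'
  simp only [Pi.single_eq_same] at h1 h2
  have h : (diffConst 0 * K p) * (pd (ex 2) (ξ v 2) p - pd (ex 1) (ξ v 1) p) = 0 := by
    linear_combination (h2 - h1) / 2
  exact sub_eq_zero.1 ((mul_eq_zero.1 h).resolve_left (mul_ne_zero hC hK))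

/-- The diffusivity has to rescale as length squared in `(y, z)` over length in `x`. -/
theorem IsInfinitesimalSymmetry.dK_eq (hv : IsInfinitesimalSymmetry M v) (hMo : IsOpen M)
    (hM : M ⊆ domain) (hp : p ∈ M) :
    dK p (v p) = K p * (2 * pd (ex 1) (ξ v 1) p - pd (ex 0) (ξ v 0) p) := by
  have h1 := hv.second_order hMo hM hp 0 0 1 0
  simp only [Pi.single_eq_same] at h1
  refine mul_left_cancel₀ (diffConst_pos 0).ne' ?_
  linear_combination - h1

theorem IsInfinitesimalSymmetry.φ_relation (hv : IsInfinitesimalSymmetry M v) (hMo : IsOpen M)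
    (hM : M ⊆ domain) (hp : p ∈ M) :
    2 * (p.2 1 * φ v 0 p) - p.2 0 * φ v 1 p =
      (p.2 0 * p.2 1) * (2 * pd (ex 1) (ξ v 1) p - pd (ex 0) (ξ v 0) p) := by
  have h := hv.dK_eq hMo hM hp
  obtain ⟨h0, h1⟩ := hM hp
  simp only [dK, K, e, ε, φ] at *
  field_simp at h
  linear_combination h

theorem IsInfinitesimalSymmetry.pd_eu_pd_ξ (hv : IsInfinitesimalSymmetry M v) (hMo : IsOpen M)
    (hM : M ⊆ domain) (hp : p ∈ M) (β : Fin 4) (a : Base) (l : Fin 3) :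
    pd (eu β) (pd a (ξ v l)) p = 0 := by
  rw [pd_comm hMo (contDiffOn_ξ hv.1 l) hp]
  exact pd_eq_zero hMo (fun q hq => hv.pd_du_ξ hMo hM hq _ l) hp a

/-- The derivative of the relation between `φ^0`, `φ^1` and the `ξ^l`. -/
theorem IsInfinitesimalSymmetry.pd_φ_relation (hv : IsInfinitesimalSymmetry M v) (hMo : IsOpen M)
    (hM : M ⊆ domain) (hp : p ∈ M) (a : Base) :
    2 * (p.2 1 * pd a (φ v 0) p + a.2 1 * φ v 0 p) - (p.2 0 * pd a (φ v 1) p + a.2 0 * φ v 1 p) =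
      (p.2 0 * p.2 1) * (2 * pd a (pd (ex 1) (ξ v 1)) p - pd a (pd (ex 0) (ξ v 0)) p)
      + (p.2 0 * a.2 1 + a.2 0 * p.2 1) * (2 * pd (ex 1) (ξ v 1) p - pd (ex 0) (ξ v 0) p) := by
  have h := pd_congr hMo (fun q hq => hv.φ_relation hMo hM hq) hp a
  have d0 := differentiableAt_dep 0 p
  have d1 := differentiableAt_dep 1 p
  have f0 := differentiableAt_of_contDiffOn hMo (contDiffOn_φ hv.1 0) hp
  have f1 := differentiableAt_of_contDiffOn hMo (contDiffOn_φ hv.1 1) hp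
  have g1 := differentiableAt_of_contDiffOn hMo
    (contDiffOn_pd hMo (contDiffOn_ξ hv.1 1) (ex 1)) hp
  have g0 := differentiableAt_of_contDiffOn hMo
    (contDiffOn_pd hMo (contDiffOn_ξ hv.1 0) (ex 0)) hp
  have k1 : DifferentiableAt ℝ (fun q : Base => q.2 1 * φ v 0 q) p := d1.mul f0
  have k2 : DifferentiableAt ℝ (fun q : Base => q.2 0 * φ v 1 q) p := d0.mul f1
  have k3 : DifferentiableAt ℝ (fun q : Base => q.2 0 * q.2 1) p := d0.mul d1
  have k4 : DifferentiableAt ℝ (fun q => 2 * pd (ex 1) (ξ v 1) q) p := g1.const_mul 2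
  have k5 : DifferentiableAt ℝ (fun q => 2 * pd (ex 1) (ξ v 1) q - pd (ex 0) (ξ v 0) q) p :=
    k4.sub g0
  rw [pd_sub (k1.const_mul 2) k2, pd_const_mul 2 k1, pd_mul d1 f0, pd_mul d0 f1, pd_mul k3 k5,
    pd_sub k4 g0, pd_const_mul 2 g1, pd_mul d0 d1, pd_dep, pd_dep] at h
  exact h

/-- Differentiate `φ_relation` in `e`: `φ^1` and the derivatives of the `ξ^l` do not depend on `e`,
so an Euler identity of degree one remains. -/
theorem IsInfinitesimalSymmetry.pd_eu_φ_zero (hv : IsInfinitesimalSymmetry M v) (hMo : IsOpen M)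
    (hM : M ⊆ domain) (hp : p ∈ M) : p.2 0 * pd (eu 0) (φ v 0) p = φ v 0 p := by
  have h := hv.pd_φ_relation hMo hM hp (eu 0)
  have h' := hv.φ_relation hMo hM hp
  rw [hv.pd_eu_pd_ξ hMo hM hp, hv.pd_eu_pd_ξ hMo hM hp,
    hv.pd_eu_φ_of_ne hMo hM hp (β := 0) (ν := 1) (by decide)] at h
  simp [eu, du] at h
  have h1 : p.2 1 ≠ 0 := (hM hp).2
  refine mul_left_cancel₀ (mul_ne_zero two_ne_zero h1) ?_
  rw [eu, du]
  linear_combination p.2 0 * h - h'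

theorem IsInfinitesimalSymmetry.pd_eu_φ_one (hv : IsInfinitesimalSymmetry M v) (hMo : IsOpen M)
    (hM : M ⊆ domain) (hp : p ∈ M) : p.2 1 * pd (eu 1) (φ v 1) p = φ v 1 p := by
  have h := hv.pd_φ_relation hMo hM hp (eu 1)
  have h' := hv.φ_relation hMo hM hp
  rw [hv.pd_eu_pd_ξ hMo hM hp, hv.pd_eu_pd_ξ hMo hM hp,
    hv.pd_eu_φ_of_ne hMo hM hp (β := 1) (ν := 0) (by decide)] at h
  simp [eu, du] at h
  have h1 : p.2 0 ≠ 0 := (hM hp).1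
  refine mul_left_cancel₀ h1 ?_
  rw [eu, du]
  linear_combination - p.2 1 * h + h'

theorem IsInfinitesimalSymmetry.pd_du_φ (hv : IsInfinitesimalSymmetry M v) (hMo : IsOpen M)
    (hM : M ⊆ domain) (hp : p ∈ M) (η : Fin 4 → ℝ) (α : Fin 4) :
    pd (du η) (φ v α) p = η α * pd (eu α) (φ v α) p := by
  rw [pd_du_eq_sum, Finset.sum_eq_single α]
  · intro β _ h
    rw [hv.pd_eu_φ_of_ne hMo hM hp h.symm, mul_zero]
  · simp

theorem IsInfinitesimalSymmetry.pd_pd_φ (hv : IsInfinitesimalSymmetry M v) (hMo : IsOpen M)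
    (hM : M ⊆ domain) (hp : p ∈ M) (a : Base) (η : Fin 4 → ℝ) (α : Fin 4) :
    pd (a + du η) (pd (a + du η) (φ v α)) p = pd a (pd a (φ v α)) p
      + 2 * η α * pd a (pd (eu α) (φ v α)) p + η α ^ 2 * pd (eu α) (pd (eu α) (φ v α)) p := by
  have hφ := contDiffOn_φ hv.1 α
  have d1 := differentiableAt_of_contDiffOn hMo (contDiffOn_pd hMo hφ a) hp
  have d2 := differentiableAt_of_contDiffOn hMo (contDiffOn_pd hMo hφ (eu α)) hp
  have key : pd (du η) (pd (eu α) (φ v α)) p = η α * pd (eu α) (pd (eu α) (φ v α)) p := by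
    rw [pd_comm hMo hφ hp, pd_congr hMo (fun q hq => hv.pd_du_φ hMo hM hq η α) hp,
      pd_const_mul _ d2]
  rw [pd_congr hMo (G := fun q => pd a (φ v α) q + η α * pd (eu α) (φ v α) q) (fun q hq => by
    rw [pd_add_dir, hv.pd_du_φ hMo hM hq]) hp, pd_add d1 (d2.const_mul _), pd_const_mul _ d2,
    pd_add_dir, pd_add_dir, key, pd_comm hMo hφ hp (du η),
    pd_congr hMo (fun q hq => hv.pd_du_φ hMo hM hq η α) hp, pd_const_mul _ d2]
  ring

/-- The `y`-component of the first prolongation of a symmetry. -/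
def prY (v : Base → Base) (p : Base) (a b : Fin 4 → ℝ) (α : Fin 4) : ℝ :=
  pd (ex 1) (φ v α) p + a α * pd (eu α) (φ v α) p
    - (pd (ex 1) (ξ v 1) p * a α + pd (ex 1) (ξ v 2) p * b α)

/-- The `z`-component of the first prolongation of a symmetry. -/
def prZ (v : Base → Base) (p : Base) (a b : Fin 4 → ℝ) (α : Fin 4) : ℝ :=
  pd (ex 2) (φ v α) p + b α * pd (eu α) (φ v α) p
    - (- pd (ex 1) (ξ v 2) p * a α + pd (ex 1) (ξ v 1) p * b α)

/-- The determining equations for jets without second derivatives with respect to `y`, `z`. -/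
theorem IsInfinitesimalSymmetry.first_order (hv : IsInfinitesimalSymmetry M v) (hMo : IsOpen M)
    (hM : M ⊆ domain) (hp : p ∈ M) (a b : Fin 4 → ℝ) (ν : Fin 4) :
    pd (ex 0) (φ v ν) p + sol p a b 0 0 ν * pd (eu ν) (φ v ν) p
      - (pd (ex 0) (ξ v 0) p * sol p a b 0 0 ν + pd (ex 0) (ξ v 1) p * a ν
        + pd (ex 0) (ξ v 2) p * b ν) =
      diffConst ν *
        (ddK p (v p) a (prY v p a b) * a ν + dK p (du a) * prY v p a b ν
          + ddK p (v p) b (prZ v p a b) * b ν + dK p (du b) * prZ v p a b ν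
          + K p * (pd (ex 1) (pd (ex 1) (φ v ν)) p
              + 2 * a ν * pd (ex 1) (pd (eu ν) (φ v ν)) p
              + a ν ^ 2 * pd (eu ν) (pd (eu ν) (φ v ν)) p
              + pd (ex 2) (pd (ex 2) (φ v ν)) p
              + 2 * b ν * pd (ex 2) (pd (eu ν) (φ v ν)) p
              + b ν ^ 2 * pd (eu ν) (pd (eu ν) (φ v ν)) p))
        + dsource ν (p, cols 0 a b) (v p, cols 0 (prY v p a b) (prZ v p a b)) := by
  have hξ := contDiffOn_ξ hv.1
  have h := hv.reduced hMo hM hp a b 0 0 ν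
  -- By the Cauchy–Riemann equations `ξ^1` and `ξ^2` are harmonic in `(y, z)`, so their Laplacians
  -- leave the identity.
  have l1 : pd (ex 1) (pd (ex 1) (ξ v 1)) p + pd (ex 2) (pd (ex 2) (ξ v 1)) p = 0 := by
    rw [pd_congr hMo (G := fun q => (-1) * pd (ex 1) (ξ v 2) q) (fun q hq => by
      rw [hv.pd_two_ξ_one hMo hM hq]; ring) hp (ex 2), pd_const_mul _
        (differentiableAt_of_contDiffOn hMo (contDiffOn_pd hMo (hξ 2) (ex 1)) hp),
      pd_comm hMo (hξ 2) hp (ex 2), pd_congr hMo (fun q hq => hv.pd_two_ξ_two hMo hM hq) hp (ex 1)]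
    ring
  have l2 : pd (ex 1) (pd (ex 1) (ξ v 2)) p + pd (ex 2) (pd (ex 2) (ξ v 2)) p = 0 := by
    rw [pd_congr hMo (fun q hq => hv.pd_two_ξ_two hMo hM hq) hp (ex 2), pd_comm hMo (hξ 1) hp,
      pd_congr hMo (F := pd (ex 2) (ξ v 1)) (G := fun q => (-1) * pd (ex 1) (ξ v 2) q)
        (fun q hq => by rw [hv.pd_two_ξ_one hMo hM hq]; ring) hp (ex 1), pd_const_mul _
        (differentiableAt_of_contDiffOn hMo (contDiffOn_pd hMo (hξ 2) (ex 1)) hp)]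
    ring
  simp only [l1, l2, hv.pd_du_φ hMo hM hp, hv.pd_pd_φ hMo hM hp, hv.pd_two_ξ_two hMo hM hp,
    ← prY.eq_1, ← prZ.eq_1, Pi.zero_apply] at h
  linear_combination h

end

section

/-! ### The first order part of the determining equations -/

variable {M : Set Base} {v : Base → Base} {p : Base}

namespace IsInfinitesimalSymmetry

/-- A gradient of `ε` alone enters the equation for `e` only through `D K`, which multiplies `φ^0_y`
or `φ^0_z`. The next two lemmas use a gradient of `e` in the same way. -/
theorem pd_ex_φ_zero (hv : IsInfinitesimalSymmetry M v) (hMo : IsOpen M)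
    (hM : M ⊆ domain) (hp : p ∈ M) :
    pd (ex 1) (φ v 0) p = 0 ∧ pd (ex 2) (φ v 0) p = 0 := by
  have h0 := hv.first_order hMo hM hp 0 0 0
  have h1 := hv.first_order hMo hM hp (Pi.single 1 1) 0 0
  have h2 := hv.first_order hMo hM hp 0 (Pi.single 1 1) 0
  obtain ⟨he, hε⟩ := hM hp
  have hr : diffConst 0 * (e p / ε p) ^ 2 ≠ 0 :=
    mul_ne_zero (diffConst_pos 0).ne' (pow_ne_zero 2 (div_ne_zero he hε))
  simp [sol, source, dsource, prY, prZ, dK, du] at h0 h1 h2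
  constructor <;> refine (mul_eq_zero.1 ?_).resolve_left hr
  · linear_combination h1 - h0
  · linear_combination h2 - h0

theorem pd_ex_φ_one (hv : IsInfinitesimalSymmetry M v) (hMo : IsOpen M)
    (hM : M ⊆ domain) (hp : p ∈ M) :
    pd (ex 1) (φ v 1) p = 0 ∧ pd (ex 2) (φ v 1) p = 0 := by
  have h0 := hv.first_order hMo hM hp 0 0 1
  have h1 := hv.first_order hMo hM hp (Pi.single 0 1) 0 1
  have h2 := hv.first_order hMo hM hp 0 (Pi.single 0 1) 1
  obtain ⟨he, hε⟩ := hM hp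
  have hr : 2 * diffConst 1 * (e p / ε p) ≠ 0 :=
    mul_ne_zero (mul_ne_zero two_ne_zero (diffConst_pos 1).ne') (div_ne_zero he hε)
  simp [sol, source, dsource, prY, prZ, dK, du] at h0 h1 h2
  constructor <;> refine (mul_eq_zero.1 ?_).resolve_left hr
  · linear_combination h0 - h1
  · linear_combination h0 - h2

theorem pd_ex_φ_three (hv : IsInfinitesimalSymmetry M v) (hMo : IsOpen M)
    (hM : M ⊆ domain) (hp : p ∈ M) :
    pd (ex 1) (φ v 3) p = 0 ∧ pd (ex 2) (φ v 3) p = 0 := by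
  have h0 := hv.first_order hMo hM hp 0 0 3
  have h1 := hv.first_order hMo hM hp (Pi.single 0 1) 0 3
  have h2 := hv.first_order hMo hM hp 0 (Pi.single 0 1) 3
  obtain ⟨he, hε⟩ := hM hp
  have hr : 2 * diffConst 3 * (e p / ε p) ≠ 0 :=
    mul_ne_zero (mul_ne_zero two_ne_zero (diffConst_pos 3).ne') (div_ne_zero he hε)
  simp [sol, source, dsource, prY, prZ, dK, du, cols] at h0 h1 h2
  constructor <;> refine (mul_eq_zero.1 ?_).resolve_left hr
  · linear_combination h0 - h1
  · linear_combination h0 - h2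

theorem pd_eu_φ_relation (hv : IsInfinitesimalSymmetry M v) (hMo : IsOpen M)
    (hM : M ⊆ domain) (hp : p ∈ M) :
    pd (eu 1) (φ v 1) p = 2 * pd (eu 0) (φ v 0) p
      - (2 * pd (ex 1) (ξ v 1) p - pd (ex 0) (ξ v 0) p) := by
  have h := hv.φ_relation hMo hM hp
  rw [← hv.pd_eu_φ_zero hMo hM hp, ← hv.pd_eu_φ_one hMo hM hp] at h
  obtain ⟨he, hε⟩ := hM hp
  refine mul_left_cancel₀ (mul_ne_zero he hε) ?_
  simp only [e, ε]
  linear_combination - h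

/-- A rotation in `(y, z)` turns the background gradient hidden in the source of the third equation,
and `φ^2` must compensate: `φ^2 - ξ^2`, the variation of `ρ₁ - z`, is free of `y`. -/
theorem pd_one_φ_two (hv : IsInfinitesimalSymmetry M v) (hMo : IsOpen M)
    (hM : M ⊆ domain) (hp : p ∈ M) : pd (ex 1) (φ v 2) p = pd (ex 1) (ξ v 2) p := by
  have h0 := hv.first_order hMo hM hp 0 0 2
  have h1 := hv.first_order hMo hM hp (Pi.single 0 1) 0 2
  obtain ⟨he, hε⟩ := hM hp
  have hr : 2 * diffConst 2 * (e p / ε p) ≠ 0 :=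
    mul_ne_zero (mul_ne_zero two_ne_zero (diffConst_pos 2).ne') (div_ne_zero he hε)
  have hC : diffConst 2 = Cρ := rfl
  simp [sol, source, dsource, prY, prZ, dK, ddK, du, dir, cols, hC] at h0 h1
  rw [hC] at hr
  refine mul_left_cancel₀ hr ?_
  linear_combination h0 - h1

theorem pd_two_φ_two (hv : IsInfinitesimalSymmetry M v) (hMo : IsOpen M)
    (hM : M ⊆ domain) (hp : p ∈ M) :
    pd (ex 2) (φ v 2) p = pd (ex 1) (ξ v 1) p - pd (eu 2) (φ v 2) p := by
  have h0 := hv.first_order hMo hM hp 0 0 2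
  have h1 := hv.first_order hMo hM hp 0 (Pi.single 0 1) 2
  obtain ⟨he, hε⟩ := hM hp
  have hr : 2 * diffConst 2 * (e p / ε p) ≠ 0 :=
    mul_ne_zero (mul_ne_zero two_ne_zero (diffConst_pos 2).ne') (div_ne_zero he hε)
  have hC : diffConst 2 = Cρ := rfl
  have hφ0 : (v p).2 0 = e p * pd (eu 0) (φ v 0) p := (hv.pd_eu_φ_zero hMo hM hp).symm
  have hφ1 : (v p).2 1 = ε p * pd (eu 1) (φ v 1) p := (hv.pd_eu_φ_one hMo hM hp).symm
  -- Linearity of `φ^0` and `φ^1` turns the variation of `e / ε` into a multiple of `e / ε`.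
  have hq : ((v p).2 0 - e p / ε p * (v p).2 1) / ε p =
      e p / ε p * (pd (eu 0) (φ v 0) p - pd (eu 1) (φ v 1) p) := by
    rw [hφ0, hφ1]; field_simp
  simp [sol, source, dsource, prY, prZ, dK, ddK, du, dir, cols, hC, hq,
    hv.pd_eu_φ_relation hMo hM hp] at h0 h1
  rw [hC] at hr
  refine mul_left_cancel₀ hr ?_
  linear_combination h0 - h1

/-- Take the part of the first equation that is odd in the gradient of `e`: once the `y`- and
`z`-derivatives of `φ^0`, `φ^1` are gone, only the drift term from `ξ^1_x` or `ξ^2_x` is left. -/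
theorem pd_zero_ξ (hv : IsInfinitesimalSymmetry M v) (hMo : IsOpen M)
    (hM : M ⊆ domain) (hp : p ∈ M) :
    pd (ex 0) (ξ v 1) p = 0 ∧ pd (ex 0) (ξ v 2) p = 0 := by
  have hφ := contDiffOn_φ hv.1 0
  have d1 : pd (ex 1) (pd (eu 0) (φ v 0)) p = 0 := by
    rw [pd_comm hMo hφ hp]
    exact pd_eq_zero hMo (fun q hq => (hv.pd_ex_φ_zero hMo hM hq).1) hp _
  have d2 : pd (ex 2) (pd (eu 0) (φ v 0)) p = 0 := by
    rw [pd_comm hMo hφ hp]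
    exact pd_eq_zero hMo (fun q hq => (hv.pd_ex_φ_zero hMo hM hq).2) hp _
  constructor
  · have h1 := hv.first_order hMo hM hp (Pi.single 0 1) 0 0
    have h2 := hv.first_order hMo hM hp (-Pi.single 0 1) 0 0
    simp [sol, source, dsource, prY, prZ, dK, ddK, du, d1, d2,
      (hv.pd_ex_φ_zero hMo hM hp).1, (hv.pd_ex_φ_one hMo hM hp).1] at h1 h2
    linear_combination (h2 - h1) / 2
  · have h1 := hv.first_order hMo hM hp 0 (Pi.single 0 1) 0
    have h2 := hv.first_order hMo hM hp 0 (-Pi.single 0 1) 0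
    simp [sol, source, dsource, prY, prZ, dK, ddK, du, d1, d2,
      (hv.pd_ex_φ_zero hMo hM hp).2, (hv.pd_ex_φ_one hMo hM hp).2] at h1 h2
    linear_combination (h2 - h1) / 2

theorem pd_eu_pd_eu (hv : IsInfinitesimalSymmetry M v) (hMo : IsOpen M)
    (hM : M ⊆ domain) (hp : p ∈ M) {α β : Fin 4} (h : α ≠ β) (a : Base) :
    pd (eu β) (pd a (φ v α)) p = 0 := by
  rw [pd_comm hMo (contDiffOn_φ hv.1 α) hp]
  exact pd_eq_zero hMo (fun q hq => hv.pd_eu_φ_of_ne hMo hM hq h) hp _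

theorem pd_zero_φ_zero_eq (hv : IsInfinitesimalSymmetry M v) (hMo : IsOpen M)
    (hM : M ⊆ domain) (hp : p ∈ M) :
    pd (ex 0) (φ v 0) p =
      p.2 1 * (pd (eu 0) (φ v 0) p - pd (ex 0) (ξ v 0) p) - φ v 1 p := by
  have h := hv.first_order hMo hM hp 0 0 0
  have d1 : pd (ex 1) (pd (ex 1) (φ v 0)) p = 0 :=
    pd_eq_zero hMo (fun q hq => (hv.pd_ex_φ_zero hMo hM hq).1) hp _
  have d2 : pd (ex 2) (pd (ex 2) (φ v 0)) p = 0 :=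
    pd_eq_zero hMo (fun q hq => (hv.pd_ex_φ_zero hMo hM hq).2) hp _
  simp [sol, source, dsource, prY, prZ, dK, du, d1, d2] at h
  simp only [φ, ε] at *
  linear_combination h

/-- Differentiate the zero-gradient identity in `ε`: apart from the explicit factor `ε`, only `φ^1`
depends on it. -/
theorem pd_eu_φ_one_eq (hv : IsInfinitesimalSymmetry M v) (hMo : IsOpen M)
    (hM : M ⊆ domain) (hp : p ∈ M) :
    pd (eu 1) (φ v 1) p = pd (eu 0) (φ v 0) p - pd (ex 0) (ξ v 0) p := by
  have h := pd_congr hMo (fun q hq => hv.pd_zero_φ_zero_eq hMo hM hq) hp (eu 1)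
  have d := differentiableAt_dep 1 p
  have f0 := differentiableAt_of_contDiffOn hMo
    (contDiffOn_pd hMo (contDiffOn_φ hv.1 0) (eu 0)) hp
  have f1 := differentiableAt_of_contDiffOn hMo (contDiffOn_φ hv.1 1) hp
  have g := differentiableAt_of_contDiffOn hMo
    (contDiffOn_pd hMo (contDiffOn_ξ hv.1 0) (ex 0)) hp
  have k : DifferentiableAt ℝ (fun q => pd (eu 0) (φ v 0) q - pd (ex 0) (ξ v 0) q) p := f0.sub g
  have k' : DifferentiableAt ℝ
    (fun q : Base => q.2 1 * (pd (eu 0) (φ v 0) q - pd (ex 0) (ξ v 0) q)) p := d.mul k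
  rw [pd_sub k' f1, pd_mul d k, pd_sub f0 g, pd_dep, hv.pd_eu_pd_eu hMo hM hp (by decide),
    hv.pd_eu_pd_eu hMo hM hp (by decide), hv.pd_eu_pd_ξ hMo hM hp,
    show (eu 1).2 1 = 1 by simp [eu, du]] at h
  linear_combination h

theorem pd_zero_φ_zero (hv : IsInfinitesimalSymmetry M v) (hMo : IsOpen M)
    (hM : M ⊆ domain) (hp : p ∈ M) : pd (ex 0) (φ v 0) p = 0 := by
  have h := hv.pd_zero_φ_zero_eq hMo hM hp
  rw [← hv.pd_eu_φ_one hMo hM hp, hv.pd_eu_φ_one_eq hMo hM hp] at h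
  linear_combination h

theorem pd_eu_φ_zero_eq (hv : IsInfinitesimalSymmetry M v) (hMo : IsOpen M)
    (hM : M ⊆ domain) (hp : p ∈ M) :
    pd (eu 0) (φ v 0) p = 2 * pd (ex 1) (ξ v 1) p - 2 * pd (ex 0) (ξ v 0) p := by
  linear_combination hv.pd_eu_φ_one_eq hMo hM hp - hv.pd_eu_φ_relation hMo hM hp

end IsInfinitesimalSymmetry

theorem pd_eq_sum (a : Base) (F : Base → ℝ) (p : Base) :
    pd a F p = ∑ i, a.1 i * pd (ex i) F p + ∑ β, a.2 β * pd (eu β) F p := by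
  have ha : a = ∑ i, a.1 i • ex i + du a.2 := by
    simp [du, ex, Fin.sum_univ_three, Prod.ext_iff, funext_iff, Fin.forall_fin_succ]
  conv_lhs => rw [ha]
  rw [pd_add_dir, pd_du_eq_sum, pd, map_sum]
  simp [pd]

theorem pd_eq_zero_of_coordinates {F : Base → ℝ} (hx : ∀ i, pd (ex i) F p = 0)
    (hu : ∀ β, pd (eu β) F p = 0) (a : Base) : pd a F p = 0 := by
  rw [pd_eq_sum]; simp [hx, hu]

/-! ### Constancy of the rates and determination of `φ^2`, `φ^3`. -/

namespace IsInfinitesimalSymmetry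

/-- The weight `φ^0_e = 2 ξ^1_y - 2 ξ^0_x` does not vary with `x, y, z`. Since `ξ^0_x` depends only
on `x`, and `ξ^1_y` does not depend on `x`, both are constant; the Cauchy–Riemann equations pass
this on to the rotation rate `ξ^2_y`. -/
theorem pd_pd_ξ_const (hv : IsInfinitesimalSymmetry M v) (hMo : IsOpen M)
    (hM : M ⊆ domain) (hp : p ∈ M) (a : Base) :
    pd a (pd (ex 0) (ξ v 0)) p = 0 ∧ pd a (pd (ex 1) (ξ v 1)) p = 0 ∧
      pd a (pd (ex 1) (ξ v 2)) p = 0 := by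
  have hξ := contDiffOn_ξ hv.1
  have k1 : pd (ex 1) (pd (ex 0) (ξ v 0)) p = 0 := by
    rw [pd_comm hMo (hξ 0) hp]; exact (hv.pd_pd_ξ_zero hMo hM hp _).1
  have k2 : pd (ex 2) (pd (ex 0) (ξ v 0)) p = 0 := by
    rw [pd_comm hMo (hξ 0) hp]; exact (hv.pd_pd_ξ_zero hMo hM hp _).2
  have l0 : pd (ex 0) (pd (ex 1) (ξ v 1)) p = 0 := by
    rw [pd_comm hMo (hξ 1) hp]; exact pd_eq_zero hMo (fun q hq => (hv.pd_zero_ξ hMo hM hq).1) hp _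
  have o0 : pd (ex 0) (pd (ex 1) (ξ v 2)) p = 0 := by
    rw [pd_comm hMo (hξ 2) hp]; exact pd_eq_zero hMo (fun q hq => (hv.pd_zero_ξ hMo hM hq).2) hp _
  have d0 := differentiableAt_of_contDiffOn hMo (contDiffOn_pd hMo (hξ 0) (ex 0)) hp
  have d1 := differentiableAt_of_contDiffOn hMo (contDiffOn_pd hMo (hξ 1) (ex 1)) hp
  have d2 := differentiableAt_of_contDiffOn hMo (contDiffOn_pd hMo (hξ 2) (ex 1)) hp
  have hf : ∀ i, pd (ex i) (pd (eu 0) (φ v 0)) p = 0 := by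
    intro i
    rw [pd_comm hMo (contDiffOn_φ hv.1 0) hp]
    refine pd_eq_zero hMo (fun q hq => ?_) hp _
    fin_cases i
    exacts [hv.pd_zero_φ_zero hMo hM hq, (hv.pd_ex_φ_zero hMo hM hq).1,
      (hv.pd_ex_φ_zero hMo hM hq).2]
  have hr : ∀ i, 2 * pd (ex i) (pd (ex 1) (ξ v 1)) p - 2 * pd (ex i) (pd (ex 0) (ξ v 0)) p = 0 := by
    intro i
    have h := hf i
    rwa [pd_congr hMo (fun q hq => hv.pd_eu_φ_zero_eq hMo hM hq) hp, pd_sub (d1.const_mul 2)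
      (d0.const_mul 2), pd_const_mul 2 d1, pd_const_mul 2 d0] at h
  have l1 : pd (ex 1) (pd (ex 1) (ξ v 1)) p = 0 := by linarith [hr 1]
  have l2 : pd (ex 2) (pd (ex 1) (ξ v 1)) p = 0 := by linarith [hr 2]
  have k0 : pd (ex 0) (pd (ex 0) (ξ v 0)) p = 0 := by linarith [hr 0]
  have o1 : pd (ex 1) (pd (ex 1) (ξ v 2)) p = 0 := by
    rw [pd_comm hMo (hξ 1) hp, pd_congr hMo (F := pd (ex 2) (ξ v 1))
      (G := fun q => (-1) * pd (ex 1) (ξ v 2) q)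
      (fun q hq => by rw [hv.pd_two_ξ_one hMo hM hq]; ring) hp, pd_const_mul _ d2] at l2
    linarith
  have o2 : pd (ex 2) (pd (ex 1) (ξ v 2)) p = 0 := by
    rw [pd_comm hMo (hξ 2) hp, pd_congr hMo (fun q hq => hv.pd_two_ξ_two hMo hM hq) hp, l1]
  refine ⟨pd_eq_zero_of_coordinates (fun i => ?_) (fun β => hv.pd_eu_pd_ξ hMo hM hp β _ _) a,
    pd_eq_zero_of_coordinates (fun i => ?_) (fun β => hv.pd_eu_pd_ξ hMo hM hp β _ _) a,
    pd_eq_zero_of_coordinates (fun i => ?_) (fun β => hv.pd_eu_pd_ξ hMo hM hp β _ _) a⟩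
  all_goals fin_cases i <;> assumption

/-- Parity in the gradient of `ρ₁`: the odd part gives the mixed derivatives of `φ^2`, the even part
`φ^2_{ρ₁ρ₁}`, and the zero-gradient instance `φ^2_x`. -/
theorem pd_φ_two (hv : IsInfinitesimalSymmetry M v) (hMo : IsOpen M)
    (hM : M ⊆ domain) (hp : p ∈ M) :
    pd (ex 0) (φ v 2) p = 0 ∧ pd (ex 1) (pd (eu 2) (φ v 2)) p = 0 ∧
      pd (ex 2) (pd (eu 2) (φ v 2)) p = 0 ∧ pd (eu 2) (pd (eu 2) (φ v 2)) p = 0 := by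
  have hφ := contDiffOn_φ hv.1 2
  have h0 := hv.first_order hMo hM hp 0 0 2
  have h1 := hv.first_order hMo hM hp (Pi.single 2 1) 0 2
  have h2 := hv.first_order hMo hM hp (-Pi.single 2 1) 0 2
  have h3 := hv.first_order hMo hM hp 0 (Pi.single 2 1) 2
  have h4 := hv.first_order hMo hM hp 0 (-Pi.single 2 1) 2
  have d1 : pd (ex 1) (pd (ex 1) (φ v 2)) p = 0 := by
    rw [pd_congr hMo (fun q hq => hv.pd_one_φ_two hMo hM hq) hp]
    exact (hv.pd_pd_ξ_const hMo hM hp _).2.2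
  have d2 : pd (ex 2) (pd (ex 2) (φ v 2)) p = - pd (ex 2) (pd (eu 2) (φ v 2)) p := by
    rw [pd_congr hMo (fun q hq => hv.pd_two_φ_two hMo hM hq) hp, pd_sub
      (differentiableAt_of_contDiffOn hMo (contDiffOn_pd hMo (contDiffOn_ξ hv.1 1) _) hp)
      (differentiableAt_of_contDiffOn hMo (contDiffOn_pd hMo hφ _) hp),
      (hv.pd_pd_ξ_const hMo hM hp _).2.1, zero_sub]
  have hC : diffConst 2 = Cρ := rfl
  have hCK : diffConst 2 * K p ≠ 0 := mul_ne_zero (diffConst_pos 2).ne' (K_ne_zero (hM hp))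
  rw [hC] at hCK
  simp [sol, source, dsource, prY, prZ, dK, ddK, du, dir, cols, d1, d2, hC,
    (hv.pd_zero_ξ hMo hM hp).1, (hv.pd_zero_ξ hMo hM hp).2,
    (hv.pd_ex_φ_zero hMo hM hp).1, (hv.pd_ex_φ_one hMo hM hp).1,
    (hv.pd_ex_φ_zero hMo hM hp).2, (hv.pd_ex_φ_one hMo hM hp).2] at h0 h1 h2 h3 h4
  have s1 : pd (ex 1) (pd (eu 2) (φ v 2)) p = 0 :=
    (mul_eq_zero.1 (by linear_combination (h2 - h1) / 4 :
      Cρ * K p * pd (ex 1) (pd (eu 2) (φ v 2)) p = 0)).resolve_left hCK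
  have s2 : pd (ex 2) (pd (eu 2) (φ v 2)) p = 0 :=
    (mul_eq_zero.1 (by linear_combination (h4 - h3) / 4 :
      Cρ * K p * pd (ex 2) (pd (eu 2) (φ v 2)) p = 0)).resolve_left hCK
  have s3 : pd (eu 2) (pd (eu 2) (φ v 2)) p = 0 :=
    (mul_eq_zero.1 (by linear_combination h0 - (h2 + h1) / 2 :
      Cρ * K p * pd (eu 2) (pd (eu 2) (φ v 2)) p = 0)).resolve_left hCK
  refine ⟨?_, s1, s2, s3⟩
  rw [h0, s2]; simp

theorem pd_pd_φ_two (hv : IsInfinitesimalSymmetry M v) (hMo : IsOpen M)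
    (hM : M ⊆ domain) (hp : p ∈ M) (a : Base) : pd a (pd (eu 2) (φ v 2)) p = 0 := by
  refine pd_eq_zero_of_coordinates (fun i => ?_) (fun β => ?_) a
  · fin_cases i
    · refine (pd_comm hMo (contDiffOn_φ hv.1 2) hp _ _).trans ?_
      exact pd_eq_zero hMo (fun q hq => (hv.pd_φ_two hMo hM hq).1) hp _
    · exact (hv.pd_φ_two hMo hM hp).2.1
    · exact (hv.pd_φ_two hMo hM hp).2.2.1
  · rcases eq_or_ne 2 β with rfl | h
    · exact (hv.pd_φ_two hMo hM hp).2.2.2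
    · exact hv.pd_eu_pd_eu hMo hM hp h _

/-- The production term is quadratic in `∂ρ₁/∂y`, so the weight of `R` is twice that of `ρ₁`. -/
theorem pd_eu_φ_three (hv : IsInfinitesimalSymmetry M v) (hMo : IsOpen M)
    (hM : M ⊆ domain) (hp : p ∈ M) : pd (eu 3) (φ v 3) p = 2 * pd (eu 2) (φ v 2) p := by
  have h0 := hv.first_order hMo hM hp 0 0 3
  have h1 := hv.first_order hMo hM hp (Pi.single 2 1) 0 3
  have hCK : 2 * diffConst 2 * K p ≠ 0 :=
    mul_ne_zero (mul_ne_zero two_ne_zero (diffConst_pos 2).ne') (K_ne_zero (hM hp))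
  have hC : diffConst 2 = Cρ := rfl
  have hK := hv.dK_eq hMo hM hp
  rw [hC] at hCK
  simp [sol, source, dsource, prY, prZ, ddK, du, dir, cols, hK, hv.pd_one_φ_two hMo hM hp,
    (hv.pd_zero_ξ hMo hM hp).1, (hv.pd_ex_φ_three hMo hM hp).1] at h0 h1
  refine mul_left_cancel₀ hCK ?_
  linear_combination h1 - h0

theorem pd_zero_φ_three_eq (hv : IsInfinitesimalSymmetry M v) (hMo : IsOpen M)
    (hM : M ⊆ domain) (hp : p ∈ M) :
    p.2 0 * pd (ex 0) (φ v 3) p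
      + p.2 1 * (CT * (φ v 3 p - p.2 3 * pd (eu 3) (φ v 3) p)) = 0 := by
  -- With `∂ρ₁/∂z = 1` and `∂ρ₁/∂y = 0` production and its variation vanish, leaving only the decay
  -- term.
  have h := hv.first_order hMo hM hp 0 (Pi.single 2 1) 3
  have d1 : pd (ex 1) (pd (ex 1) (φ v 3)) p = 0 :=
    pd_eq_zero hMo (fun q hq => (hv.pd_ex_φ_three hMo hM hq).1) hp _
  have d2 : pd (ex 2) (pd (ex 2) (φ v 3)) p = 0 :=
    pd_eq_zero hMo (fun q hq => (hv.pd_ex_φ_three hMo hM hq).2) hp _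
  have hφ0 : (v p).2 0 = e p * pd (eu 0) (φ v 0) p := (hv.pd_eu_φ_zero hMo hM hp).symm
  have hφ1 : (v p).2 1 = ε p * pd (eu 1) (φ v 1) p := (hv.pd_eu_φ_one hMo hM hp).symm
  obtain ⟨he, hε⟩ := hM hp
  simp [sol, source, dsource, prY, prZ, ddK, dK, du, dir, cols, d1, d2, hφ0, hφ1,
    hv.pd_eu_φ_one_eq hMo hM hp, (hv.pd_zero_ξ hMo hM hp).2,
    (hv.pd_ex_φ_three hMo hM hp).2] at h
  field_simp at h
  simp only [φ, e, ε, R] at *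
  linear_combination h

/-- Differentiating `pd_zero_φ_three_eq` in `ε` isolates the coefficient of `ε`, because `φ^3` does
not depend on `ε`; then `CT ≠ 0` gives linearity in `R`. -/
theorem φ_three (hv : IsInfinitesimalSymmetry M v) (hMo : IsOpen M)
    (hM : M ⊆ domain) (hp : p ∈ M) : φ v 3 p = p.2 3 * (2 * pd (eu 2) (φ v 2) p) := by
  have h := pd_eq_zero hMo (fun q hq => hv.pd_zero_φ_three_eq hMo hM hq) hp (eu 1)
  have d0 := differentiableAt_dep 0 p
  have d1 := differentiableAt_dep 1 p
  have d3 := differentiableAt_dep 3 p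
  have f := differentiableAt_of_contDiffOn hMo (contDiffOn_φ hv.1 3) hp
  have fx := differentiableAt_of_contDiffOn hMo (contDiffOn_pd hMo (contDiffOn_φ hv.1 3) (ex 0)) hp
  have fu := differentiableAt_of_contDiffOn hMo (contDiffOn_pd hMo (contDiffOn_φ hv.1 3) (eu 3)) hp
  have k0 : DifferentiableAt ℝ (fun q : Base => q.2 0 * pd (ex 0) (φ v 3) q) p := d0.mul fx
  have k1 : DifferentiableAt ℝ (fun q : Base => q.2 3 * pd (eu 3) (φ v 3) q) p := d3.mul fu
  have k2 : DifferentiableAt ℝ (fun q : Base => φ v 3 q - q.2 3 * pd (eu 3) (φ v 3) q) p :=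
    f.sub k1
  have k3 : DifferentiableAt ℝ
    (fun q : Base => CT * (φ v 3 q - q.2 3 * pd (eu 3) (φ v 3) q)) p := k2.const_mul CT
  have k4 : DifferentiableAt ℝ
    (fun q : Base => q.2 1 * (CT * (φ v 3 q - q.2 3 * pd (eu 3) (φ v 3) q))) p := d1.mul k3
  rw [pd_add k0 k4, pd_mul d0 fx, pd_mul d1 k3, pd_const_mul CT k2, pd_sub f k1, pd_mul d3 fu,
    pd_dep, pd_dep, pd_dep, hv.pd_eu_pd_eu hMo hM hp (by decide),
    hv.pd_eu_pd_eu hMo hM hp (by decide), hv.pd_eu_φ_of_ne hMo hM hp (by decide)] at h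
  have hCT : CT ≠ 0 := by norm_num [CT]
  simp [eu, du, hCT] at h
  rw [← hv.pd_eu_φ_three hMo hM hp]
  rw [eu, du]
  linear_combination h

end IsInfinitesimalSymmetry

end

section

/-! ### Linear combinations of the eight vector fields -/

variable {M : Set Base} {v : Base → Base} {p : Base}

theorem sum_X_apply (c : Fin 8 → ℝ) (p : Base) :
    (∑ i, c i • X i) p =
      (![c 0 + c 6 * p.1 0, c 1 - c 4 * p.1 2 + c 5 * p.1 1, c 2 + c 4 * p.1 1 + c 5 * p.1 2],
        ![(2 * c 5 - 2 * c 6) * p.2 0, (2 * c 5 - 3 * c 6) * p.2 1,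
          c 3 + c 4 * p.1 1 - c 7 * p.1 2 + (c 5 + c 7) * p.2 2, 2 * (c 5 + c 7) * p.2 3]) := by
  have hX : ∀ i, X i = ![X₁, X₂, X₃, X₄, X₅, X₆, X₇, X₈] i := fun _ => rfl
  ext i
  · fin_cases i <;>
    · simp [Fin.sum_univ_eight, hX, X₁, X₂, X₃, X₄, X₅, X₆, X₇, X₈]
      try ring
  · fin_cases i <;>
    · simp [Fin.sum_univ_eight, hX, X₁, X₂, X₃, X₄, X₅, X₆, X₇, X₈, e, ε, ρ₁, R]
      try ring

/-- The linear part of a linear combination of the eight vector fields. -/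
def linX (c : Fin 8 → ℝ) : Base →L[ℝ] Base :=
  LinearMap.toContinuousLinearMap
    { toFun := fun p =>
        (![c 6 * p.1 0, - c 4 * p.1 2 + c 5 * p.1 1, c 4 * p.1 1 + c 5 * p.1 2],
          ![(2 * c 5 - 2 * c 6) * p.2 0, (2 * c 5 - 3 * c 6) * p.2 1,
            c 4 * p.1 1 - c 7 * p.1 2 + (c 5 + c 7) * p.2 2, 2 * (c 5 + c 7) * p.2 3])
      map_add' := fun p q => by
        ext i
        · fin_cases i <;> simp <;> ring
        · fin_cases i <;> simp <;> ring
      map_smul' := fun t q => by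
        ext i
        · fin_cases i <;> simp <;> ring
        · fin_cases i <;> simp <;> ring }

theorem linX_apply (c : Fin 8 → ℝ) (p : Base) : linX c p =
    (![c 6 * p.1 0, - c 4 * p.1 2 + c 5 * p.1 1, c 4 * p.1 1 + c 5 * p.1 2],
      ![(2 * c 5 - 2 * c 6) * p.2 0, (2 * c 5 - 3 * c 6) * p.2 1,
        c 4 * p.1 1 - c 7 * p.1 2 + (c 5 + c 7) * p.2 2, 2 * (c 5 + c 7) * p.2 3]) := rfl

theorem sum_X_eq (c : Fin 8 → ℝ) :
    ∑ i, c i • X i = fun p => linX c p + (![c 0, c 1, c 2], ![0, 0, c 3, 0]) := by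
  ext p i
  · rw [sum_X_apply, linX_apply]; fin_cases i <;> simp <;> ring
  · rw [sum_X_apply, linX_apply]; fin_cases i <;> simp <;> ring

theorem contDiff_sum_X (c : Fin 8 → ℝ) : ContDiff ℝ ∞ (∑ i, c i • X i) := by
  rw [sum_X_eq]; exact (linX c).contDiff.add contDiff_const

theorem hasFDerivAt_sum_X (c : Fin 8 → ℝ) (p : Base) :
    HasFDerivAt (∑ i, c i • X i) (linX c) p := by
  rw [sum_X_eq]; exact (linX c).hasFDerivAt.add_const _

theorem pd_ξ_sum_X (c : Fin 8 → ℝ) (p a : Base) (l : Fin 3) :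
    pd a (ξ (∑ i, c i • X i) l) p = (linX c a).1 l := by
  have h := (((ContinuousLinearMap.proj (R := ℝ) (φ := fun _ : Fin 3 => ℝ) l).comp
    (ContinuousLinearMap.fst ℝ _ (Fin 4 → ℝ))).hasFDerivAt).comp p (hasFDerivAt_sum_X c p)
  exact congrArg (fun L : Base →L[ℝ] ℝ => L a) h.fderiv

theorem pd_φ_sum_X (c : Fin 8 → ℝ) (p a : Base) (α : Fin 4) :
    pd a (φ (∑ i, c i • X i) α) p = (linX c a).2 α := by
  have h := (((ContinuousLinearMap.proj (R := ℝ) (φ := fun _ : Fin 4 => ℝ) α).comp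
    (ContinuousLinearMap.snd ℝ (Fin 3 → ℝ) _)).hasFDerivAt).comp p (hasFDerivAt_sum_X c p)
  exact congrArg (fun L : Base →L[ℝ] ℝ => L a) h.fderiv

theorem linX_ex_zero (c : Fin 8 → ℝ) : linX c (ex 0) = (![c 6, 0, 0], ![0, 0, 0, 0]) := by
  simp [linX_apply, ex]

theorem linX_ex_one (c : Fin 8 → ℝ) : linX c (ex 1) = (![0, c 5, c 4], ![0, 0, c 4, 0]) := by
  simp [linX_apply, ex]

theorem linX_ex_two (c : Fin 8 → ℝ) : linX c (ex 2) = (![0, - c 4, c 5], ![0, 0, - c 7, 0]) := by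
  simp [linX_apply, ex]

theorem linX_du (c : Fin 8 → ℝ) (η : Fin 4 → ℝ) : linX c (du η) =
    (![0, 0, 0], ![(2 * c 5 - 2 * c 6) * η 0, (2 * c 5 - 3 * c 6) * η 1, (c 5 + c 7) * η 2,
      2 * (c 5 + c 7) * η 3]) := by
  simp [linX_apply, du]

theorem IsJet.eq_hess {j : Jet2} (hj : IsJet j) :
    j = ((j.1.1, cols (fun α => j.1.2 α 0) (fun α => j.1.2 α 1) (fun α => j.1.2 α 2)),
      hess (fun α => j.2 α 0 0) (fun α => j.2 α 0 1) (fun α => j.2 α 0 2) (fun α => j.2 α 1 1)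
        (fun α => j.2 α 2 2) (fun α => j.2 α 1 2)) := by
  refine Prod.ext (Prod.ext rfl ?_) ?_
  · ext α i
    fin_cases i <;> rfl
  · ext α i k
    fin_cases i <;> fin_cases k <;> first | rfl | exact hj α _ _

/-- The linear combinations of the eight vector fields are infinitesimal symmetries. -/
theorem isInfinitesimalSymmetry_of_eqOn (hMo : IsOpen M) (hM : M ⊆ domain) (c : Fin 8 → ℝ)
    (hv : Set.EqOn v (∑ i, c i • X i) M) : IsInfinitesimalSymmetry M v := by
  have hs : ContDiffOn ℝ ∞ v M := (contDiff_sum_X c).contDiffOn.congr hv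
  refine ⟨hs, fun j hj hp hΔ ν => ?_⟩
  obtain ⟨he, hε⟩ := hM hp
  -- Since `v` is affine on the open set `M`, its first derivatives there are those of `linX c` and
  -- its second derivatives vanish.
  have hξ : ∀ q ∈ M, ∀ a l, pd a (ξ v l) q = (linX c a).1 l := fun q hq a l => by
    rw [← pd_ξ_sum_X c q a l]
    exact pd_congr hMo (fun q hq => by simp only [ξ, hv hq]) hq a
  have hφ : ∀ q ∈ M, ∀ a α, pd a (φ v α) q = (linX c a).2 α := fun q hq a α => by
    rw [← pd_φ_sum_X c q a α]
    exact pd_congr hMo (fun q hq => by simp only [φ, hv hq]) hq a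
  have hξ₂ : ∀ q ∈ M, ∀ a b l, pd a (pd b (ξ v l)) q = 0 := fun q hq a b l => by
    rw [pd_congr hMo (fun q hq => hξ q hq b l) hq a]; simp [pd]
  have hφ₂ : ∀ q ∈ M, ∀ a b α, pd a (pd b (φ v α)) q = 0 := fun q hq a b α => by
    rw [pd_congr hMo (fun q hq => hφ q hq b α) hq a]; simp [pd]
  have hc : ∀ ν, j.1.2 ν 0 = sol j.1.1 (fun α => j.1.2 α 1) (fun α => j.1.2 α 2)
      (fun α => j.2 α 1 1) (fun α => j.2 α 2 2) ν := fun ν => by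
    have h := hΔ ν
    rw [Δ_eq ν hε, hj.eq_hess, source_cols] at h
    simp [cols, diffTerm, hess, dK_dir] at h
    rw [sol]
    linear_combination h
  rw [hj.eq_hess, funext hc]
  -- With the `x`-derivatives eliminated by `hc`, the remaining jet coordinates are independent and
  -- the claim is an algebraic identity in them.
  generalize (fun α => j.1.2 α 1) = a
  generalize (fun α => j.1.2 α 2) = b
  generalize (fun α => j.2 α 1 1) = P
  generalize (fun α => j.2 α 2 2) = Q
  generalize (fun α => j.2 α 0 0) = o
  generalize (fun α => j.2 α 0 1) = m
  generalize (fun α => j.2 α 0 2) = n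
  generalize (fun α => j.2 α 1 2) = T
  generalize j.1.1 = p at *
  rw [fderiv_Δ_prolongation hMo hM hs hp (sol p a b P Q) a b o m n P Q T ν rfl rfl rfl]
  have hvp := (hv hp).trans (sum_X_apply c p)
  have hvp0 : (v p).2 0 = (2 * c 5 - 2 * c 6) * e p := by rw [hvp]; rfl
  have hvp1 : (v p).2 1 = (2 * c 5 - 3 * c 6) * ε p := by rw [hvp]; rfl
  have hvp3 : (v p).2 3 = 2 * (c 5 + c 7) * R p := by rw [hvp]; rfl
  have hdu : ∀ η, dK p (du η) = 2 * (e p / ε p) * η 0 - (e p / ε p) ^ 2 * η 1 := fun _ => rfl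
  have hdK : dK p (v p) = (2 * c 5 - c 6) * K p := by
    simp only [dK, K, hvp0, hvp1]; field_simp; ring
  have hdd : ∀ u w, ddK p (v p) u w =
      2 * (c 6 * (e p / ε p)) * (u 0 - e p / ε p * u 1)
        + (2 * (e p / ε p) * w 0 - (e p / ε p) ^ 2 * w 1) := fun u w => by
    simp only [ddK, dK, hvp0, hvp1]; field_simp; ring
  clear hvp hc
  fin_cases ν
  · simp [pr₁, pr₂, hξ p hp, hφ p hp, hξ₂ p hp, hφ₂ p hp, linX_du, linX_ex_zero, linX_ex_one,
      linX_ex_two, sol, source, dsource, hdd, hdu, hdK, hvp1, diffConst]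
    ring
  · simp [pr₁, pr₂, hξ p hp, hφ p hp, hξ₂ p hp, hφ₂ p hp, linX_du, linX_ex_zero, linX_ex_one,
      linX_ex_two, sol, source, dsource, hdd, hdu, hdK, hvp0, hvp1, diffConst]
    field_simp
    ring
  · simp [pr₁, pr₂, hξ p hp, hφ p hp, hξ₂ p hp, hφ₂ p hp, linX_du, linX_ex_zero, linX_ex_one,
      linX_ex_two, sol, source, dsource, hdd, hdu, hdK, diffConst, dK_dir, cols]
    ring
  · simp [pr₁, pr₂, hξ p hp, hφ p hp, hξ₂ p hp, hφ₂ p hp, linX_du, linX_ex_zero, linX_ex_one,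
      linX_ex_two, sol, source, dsource, hdd, hdu, hdK, hvp0, hvp1, hvp3, diffConst, cols]
    field_simp
    ring

end

section

/-! ### Classification -/

variable {M : Set Base} {v w : Base → Base} {p : Base}

theorem eqOn_of_pd_eq {F G : Base → ℝ} {p₀ : Base} (hMo : IsOpen M) (hMc : IsPreconnected M)
    (hF : ContDiffOn ℝ ∞ F M) (hG : ContDiffOn ℝ ∞ G M) (hp₀ : p₀ ∈ M) (h₀ : F p₀ = G p₀)
    (hx : ∀ p ∈ M, ∀ i, pd (ex i) F p = pd (ex i) G p)
    (hu : ∀ p ∈ M, ∀ β, pd (eu β) F p = pd (eu β) G p) : Set.EqOn F G M := by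
  refine hMo.eqOn_of_fderiv_eq hMc (hF.differentiableOn (by simp)) (hG.differentiableOn (by simp))
    (fun p hp => ?_) hp₀ h₀
  refine ContinuousLinearMap.ext fun a => ?_
  change pd a F p = pd a G p
  rw [pd_eq_sum, pd_eq_sum]
  simp only [hx p hp, hu p hp]

theorem eq_of_pd_eq_zero {F : Base → ℝ} {p₀ : Base} (hMo : IsOpen M) (hMc : IsPreconnected M)
    (hF : ContDiffOn ℝ ∞ F M) (hp₀ : p₀ ∈ M) (h : ∀ p ∈ M, ∀ a, pd a F p = 0) (hp : p ∈ M) :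
    F p = F p₀ :=
  eqOn_of_pd_eq hMo hMc hF (contDiffOn_const (c := F p₀)) hp₀ rfl
    (fun p hp i => by rw [h p hp]; simp [pd]) (fun p hp i => by rw [h p hp]; simp [pd]) hp

/-- The rates `κ`, `μ`, `τ`, `s` are constant on the connected set `M`. Hence `ξ^l` and `φ^2` have
the first derivatives of an affine combination and need only agree with it at `p₀`; `φ^0`, `φ^1`,
`φ^3` are already known pointwise. -/
theorem IsInfinitesimalSymmetry.exists_eqOn (hv : IsInfinitesimalSymmetry M v) (hMo : IsOpen M)
    (hMc : IsConnected M) (hM : M ⊆ domain) :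
    ∃ c : Fin 8 → ℝ, Set.EqOn v (∑ i, c i • X i) M := by
  obtain ⟨p₀, hp₀⟩ := hMc.nonempty
  have hξ := contDiffOn_ξ hv.1
  have hφ := contDiffOn_φ hv.1
  obtain ⟨κ, hκ⟩ : ∃ κ, ∀ p ∈ M, pd (ex 0) (ξ v 0) p = κ := ⟨_, fun p hp =>
    eq_of_pd_eq_zero hMo hMc.isPreconnected (contDiffOn_pd hMo (hξ 0) _) hp₀
      (fun q hq a => (hv.pd_pd_ξ_const hMo hM hq a).1) hp⟩
  obtain ⟨μ, hμ⟩ : ∃ μ, ∀ p ∈ M, pd (ex 1) (ξ v 1) p = μ := ⟨_, fun p hp =>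
    eq_of_pd_eq_zero hMo hMc.isPreconnected (contDiffOn_pd hMo (hξ 1) _) hp₀
      (fun q hq a => (hv.pd_pd_ξ_const hMo hM hq a).2.1) hp⟩
  obtain ⟨τ, hτ⟩ : ∃ τ, ∀ p ∈ M, pd (ex 1) (ξ v 2) p = τ := ⟨_, fun p hp =>
    eq_of_pd_eq_zero hMo hMc.isPreconnected (contDiffOn_pd hMo (hξ 2) _) hp₀
      (fun q hq a => (hv.pd_pd_ξ_const hMo hM hq a).2.2) hp⟩
  obtain ⟨s, hs⟩ : ∃ s, ∀ p ∈ M, pd (eu 2) (φ v 2) p = s := ⟨_, fun p hp =>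
    eq_of_pd_eq_zero hMo hMc.isPreconnected (contDiffOn_pd hMo (hφ 2) _) hp₀
      (fun q hq a => hv.pd_pd_φ_two hMo hM hq a) hp⟩
  -- The first four coefficients match the values at `p₀`. Both `X₆` and `X₈` scale `ρ₁`, so `s = c
  -- 5 + c 7` and `c 7 = s - μ`.
  obtain ⟨c, hc0, hc1, hc2, hc3, hc4, hc5, hc6, hc7⟩ : ∃ c : Fin 8 → ℝ,
      c 0 = ξ v 0 p₀ - κ * p₀.1 0 ∧ c 1 = ξ v 1 p₀ + τ * p₀.1 2 - μ * p₀.1 1 ∧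
      c 2 = ξ v 2 p₀ - τ * p₀.1 1 - μ * p₀.1 2 ∧
      c 3 = φ v 2 p₀ - τ * p₀.1 1 + (s - μ) * p₀.1 2 - s * p₀.2 2 ∧
      c 4 = τ ∧ c 5 = μ ∧ c 6 = κ ∧ c 7 = s - μ :=
    ⟨![ξ v 0 p₀ - κ * p₀.1 0, ξ v 1 p₀ + τ * p₀.1 2 - μ * p₀.1 1,
      ξ v 2 p₀ - τ * p₀.1 1 - μ * p₀.1 2, φ v 2 p₀ - τ * p₀.1 1 + (s - μ) * p₀.1 2 - s * p₀.2 2,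
      τ, μ, κ, s - μ], rfl, rfl, rfl, rfl, rfl, rfl, rfl, rfl⟩
  have hX : ∀ p, (∑ i, c i • X i) p = _ := sum_X_apply c
  have hXs := contDiff_sum_X c
  have hpdξ := pd_ξ_sum_X c
  have hpdφ := pd_φ_sum_X c
  have e0 : Set.EqOn (ξ v 0) (ξ (∑ i, c i • X i) 0) M := by
    refine eqOn_of_pd_eq hMo hMc.isPreconnected (hξ 0) (contDiffOn_ξ hXs.contDiffOn 0) hp₀ ?_
      (fun p hp i => ?_) (fun p hp β => ?_)
    · rw [ξ.eq_1 (∑ i, c i • X i), hX]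
      simp [hc0, hc4, hc5, hc6]
    · rw [hpdξ]
      fin_cases i
      · simp [linX_ex_zero, hκ p hp, hc6]
      · simp [linX_ex_one, hv.pd_one_ξ_zero hMo hM hp]
      · simp [linX_ex_two, hv.pd_two_ξ_zero hMo hM hp]
    · rw [hpdξ, eu, hv.pd_du_ξ hMo hM hp, linX_du]; rfl
  have e1 : Set.EqOn (ξ v 1) (ξ (∑ i, c i • X i) 1) M := by
    refine eqOn_of_pd_eq hMo hMc.isPreconnected (hξ 1) (contDiffOn_ξ hXs.contDiffOn 1) hp₀ ?_
      (fun p hp i => ?_) (fun p hp β => ?_)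
    · rw [ξ.eq_1 (∑ i, c i • X i), hX]
      simp [hc1, hc4, hc5, hc6]
      ring
    · rw [hpdξ]
      fin_cases i
      · simp [linX_ex_zero, (hv.pd_zero_ξ hMo hM hp).1]
      · simp [linX_ex_one, hμ p hp, hc5]
      · simp [linX_ex_two, hv.pd_two_ξ_one hMo hM hp, hτ p hp, hc4]
    · rw [hpdξ, eu, hv.pd_du_ξ hMo hM hp, linX_du]; rfl
  have e2 : Set.EqOn (ξ v 2) (ξ (∑ i, c i • X i) 2) M := by
    refine eqOn_of_pd_eq hMo hMc.isPreconnected (hξ 2) (contDiffOn_ξ hXs.contDiffOn 2) hp₀ ?_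
      (fun p hp i => ?_) (fun p hp β => ?_)
    · rw [ξ.eq_1 (∑ i, c i • X i), hX]
      simp [hc2, hc4, hc5, hc6]
      ring
    · rw [hpdξ]
      fin_cases i
      · simp [linX_ex_zero, (hv.pd_zero_ξ hMo hM hp).2]
      · simp [linX_ex_one, hτ p hp, hc4]
      · simp [linX_ex_two, hv.pd_two_ξ_two hMo hM hp, hμ p hp, hc5]
    · rw [hpdξ, eu, hv.pd_du_ξ hMo hM hp, linX_du]; rfl
  have f2 : Set.EqOn (φ v 2) (φ (∑ i, c i • X i) 2) M := by
    refine eqOn_of_pd_eq hMo hMc.isPreconnected (hφ 2) (contDiffOn_φ hXs.contDiffOn 2) hp₀ ?_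
      (fun p hp i => ?_) (fun p hp β => ?_)
    · rw [φ.eq_1 (∑ i, c i • X i), hX]
      simp [hc3, hc4, hc5, hc7]
      ring
    · rw [hpdφ]
      fin_cases i
      · simp [linX_ex_zero, (hv.pd_φ_two hMo hM hp).1]
      · simp [linX_ex_one, hv.pd_one_φ_two hMo hM hp, hτ p hp, hc4]
      · simp [linX_ex_two, hv.pd_two_φ_two hMo hM hp, hs p hp, hμ p hp, hc7]
    · rw [hpdφ, eu, hv.pd_du_φ hMo hM hp, linX_du, hs p hp]
      simp [hc5, hc7, mul_comm]
  have f0 : ∀ p ∈ M, φ v 0 p = (2 * c 5 - 2 * c 6) * p.2 0 := fun p hp => by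
    rw [← hv.pd_eu_φ_zero hMo hM hp, hv.pd_eu_φ_zero_eq hMo hM hp, hκ p hp, hμ p hp, hc5, hc6]
    ring
  have f1 : ∀ p ∈ M, φ v 1 p = (2 * c 5 - 3 * c 6) * p.2 1 := fun p hp => by
    rw [← hv.pd_eu_φ_one hMo hM hp, hv.pd_eu_φ_one_eq hMo hM hp, hv.pd_eu_φ_zero_eq hMo hM hp,
      hκ p hp, hμ p hp, hc5, hc6]
    ring
  have f3 : ∀ p ∈ M, φ v 3 p = 2 * (c 5 + c 7) * p.2 3 := fun p hp => by
    rw [hv.φ_three hMo hM hp, hs p hp, hc5, hc7]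
    ring
  refine ⟨c, fun p hp => Prod.ext (funext fun l => ?_) (funext fun α => ?_)⟩
  · fin_cases l
    exacts [e0 hp, e1 hp, e2 hp]
  · fin_cases α
    · exact (f0 p hp).trans (by rw [hX]; rfl)
    · exact (f1 p hp).trans (by rw [hX]; rfl)
    · exact f2 hp
    · exact (f3 p hp).trans (by rw [hX]; rfl)

theorem isInfinitesimalSymmetry_iff (hMo : IsOpen M) (hMc : IsConnected M) (hM : M ⊆ domain) :
    IsInfinitesimalSymmetry M v ↔ ∃ c : Fin 8 → ℝ, Set.EqOn v (∑ i, c i • X i) M :=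
  ⟨fun hv => hv.exists_eqOn hMo hMc hM,
    fun ⟨c, hc⟩ => isInfinitesimalSymmetry_of_eqOn hMo hM c hc⟩

/-- A combination vanishing on an open set has zero derivative, which kills the coefficients of `X₅`
to `X₈`; the value at a point kills those of the translations. -/
theorem linearIndependent_X (hMo : IsOpen M) (hM : M.Nonempty) :
    LinearIndependent ℝ (fun (i : Fin 8) (p : M) => X i p) := by
  obtain ⟨p, hp⟩ := hM
  refine Fintype.linearIndependent_iff.2 fun c hc => ?_
  have h : ∀ q ∈ M, (∑ i, c i • X i) q = 0 := fun q hq => by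
    have := congrFun hc ⟨q, hq⟩
    simpa using this
  have hL : ∀ a, linX c a = 0 := fun a => by
    have hev : (∑ i, c i • X i) =ᶠ[nhds p] fun _ => 0 :=
      Filter.eventuallyEq_of_mem (hMo.mem_nhds hp) h
    have h1 := (hasFDerivAt_sum_X c p).unique ((hasFDerivAt_const 0 p).congr_of_eventuallyEq hev)
    simp [h1]
  have h0 := hL (ex 0)
  have h1 := hL (ex 1)
  have h2 := hL (ex 2)
  have h3 := h p hp
  rw [sum_X_apply] at h3
  simp [linX_ex_zero, linX_ex_one, linX_ex_two, Prod.ext_iff, funext_iff, Fin.forall_fin_succ]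
    at h0 h1 h2 h3
  have h4 : c 4 = 0 := h1.2
  have h5 : c 5 = 0 := h1.1
  have h7 : c 7 = 0 := h2.2
  simp [h0, h4, h5, h7] at h3
  intro i
  fin_cases i <;> simp [h0, h4, h5, h7, h3]

/-- The Lie bracket of two linear combinations of the eight vector fields. -/
theorem eqOn_lieBracket (hMo : IsOpen M) {c d : Fin 8 → ℝ} (hv : Set.EqOn v (∑ i, c i • X i) M)
    (hw : Set.EqOn w (∑ i, d i • X i) M) :
    Set.EqOn (VectorField.lieBracket ℝ v w)
      -- The last four entries vanish because the linear parts of the combinations commute; the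
      -- bracket is always a combination of the translations `X₁` to `X₄`.
      (∑ i, (![d 6 * c 0 - c 6 * d 0, - d 4 * c 2 + d 5 * c 1 + c 4 * d 2 - c 5 * d 1,
        d 4 * c 1 + d 5 * c 2 - c 4 * d 1 - c 5 * d 2,
        d 4 * c 1 + (d 5 + d 7) * c 3 - d 7 * c 2 - (c 4 * d 1 + (c 5 + c 7) * d 3 - c 7 * d 2),
        0, 0, 0, 0] : Fin 8 → ℝ) i • X i) M := by
  intro p hp
  have h : ∀ {u : Base → Base} {b : Fin 8 → ℝ}, Set.EqOn u (∑ i, b i • X i) M →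
      fderiv ℝ u p = linX b := fun {u b} hu =>
    ((Filter.eventuallyEq_of_mem (hMo.mem_nhds hp) hu).fderiv_eq).trans
      (hasFDerivAt_sum_X b p).fderiv
  rw [VectorField.lieBracket, h hv, h hw, hv hp, hw hp, sum_X_apply, sum_X_apply, sum_X_apply,
    linX_apply, linX_apply]
  refine Prod.ext (funext fun l => ?_) (funext fun α => ?_)
  · fin_cases l <;> simp <;> ring
  · fin_cases α <;> simp <;> ring

end

end FarWake

end

theorem mainTheorem1 (M : Set FarWake.Base) (hMo : IsOpen M) (hMc : IsConnected M)
    (hM : M ⊆ FarWake.domain) :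
    (∀ v : FarWake.Base → FarWake.Base, FarWake.IsInfinitesimalSymmetry M v ↔
      ∃ c : Fin 8 → ℝ, Set.EqOn v (∑ i, c i • FarWake.X i) M) ∧
    LinearIndependent ℝ (fun (i : Fin 8) (p : M) => FarWake.X i p) ∧
    (∀ v w : FarWake.Base → FarWake.Base,
      FarWake.IsInfinitesimalSymmetry M v → FarWake.IsInfinitesimalSymmetry M w →
        FarWake.IsInfinitesimalSymmetry M (VectorField.lieBracket ℝ v w)) := by
  refine ⟨fun v => FarWake.isInfinitesimalSymmetry_iff hMo hMc hM,
    FarWake.linearIndependent_X hMo hMc.nonempty, fun v w hv hw => ?_⟩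
  obtain ⟨c, hc⟩ := hv.exists_eqOn hMo hMc hM
  obtain ⟨d, hd⟩ := hw.exists_eqOn hMo hMc hM
  exact FarWake.isInfinitesimalSymmetry_of_eqOn hMo hM _ (FarWake.eqOn_lieBracket hMo hc hd)
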